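/- For $a\in\mathbb{R}$ consider the ordinary differential equation $$U''''+aU''+U^3-U=0.\qquad(1)$$ A meromorphic solution of (1) is a meromorphic function $U$ on $\mathbb{C}$ that satisfies (1) away from its poles. Call it real if it has no pole on $\mathbb{R}$ and $U(\mathbb{R})\subset\mathbb{R}$, and call a real one homoclinic if it is not constant and there is $p\in\mathbb{R}$ such that, for real $Z$, $(U,U',U'',U''')(Z)\to(p,0,0,0)$ both as $Z\to-\infty$ and as $Z\to+\infty$. Let $k\in\mathbb{R}$ with $k^2=\frac{1}{4\sqrt{11}}$. (i) If (1) with $a\in\mathbb{R}$ has a real homoclinic meromorphic solution $U$, then $a=\frac{10}{\sqrt{11}}$, and there are $\varepsilon\in\{1,-1\}$ and $Z_0\in\mathbb{R}$ such that $$U(Z)=\varepsilon\,\frac{4\sqrt{30}}{\sqrt{11}}\,\frac{\bigl(1-\tanh^2 k(Z-Z_0)\bigr)\tanh k(Z-Z_0)}{\bigl(1+\tanh^2 k(Z-Z_0)\bigr)^2}\qquad(2)$$ as meromorphic functions on $\mathbb{C}$. (ii) Conversely, for all $\varepsilon\in\{1,-1\}$ and $Z_0\in\mathbb{R}$ the function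 (2) is a real homoclinic meromorphic solution of (1) with $a=\frac{10}{\sqrt{11}}$. On the real line it has exactly one local maximum and exactly one local minimum; they are attained where $\tanh k(Z-Z_0)=\varepsilon(\sqrt2-1)$ and where $\tanh k(Z-Z_0)=-\varepsilon(\sqrt2-1)$, with values $\sqrt{30/11}$ and $-\sqrt{30/11}$ respectively, and $|U(Z)|\le\sqrt{30/11}$ for all $Z\in\mathbb{R}$. -/

import Mathlib

open Filter Topology

/-- `U` is a meromorphic function on the whole complex plane which solves
`U'''' + a U'' + U ^ 3 - U = 0`. The values that the Lean function `U` takes at its poles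
are irrelevant, so the equation is asked for at every point where `U` is analytic. -/
def IsMeromorphicSolution (a : ℝ) (U : ℂ → ℂ) : Prop :=
  Meromorphic U ∧
    ∀ z : ℂ, AnalyticAt ℂ U z →
      iteratedDeriv 4 U z + (a : ℂ) * iteratedDeriv 2 U z + U z ^ 3 - U z = 0

/-- `U` is real on the real line: it has no real pole and takes real values there. -/
def IsRealOnReals (U : ℂ → ℂ) : Prop :=
  ∀ x : ℝ, AnalyticAt ℂ U (x : ℂ) ∧ (U (x : ℂ)).im = 0

/-- The real function obtained by restricting `U` to the real line. -/
def realTrace (U : ℂ → ℂ) (x : ℝ) : ℝ := (U (x : ℂ)).re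

/-- A solution `u : ℝ → ℝ` of a fourth order autonomous equation is homoclinic if it is not
constant and its orbit `(u, u', u'', u''')` in phase space tends to one and the same
point `(p, 0, 0, 0)` at `-∞` and at `+∞` (this point is then an equilibrium). -/
def IsHomoclinic (u : ℝ → ℝ) : Prop :=
  (∃ x y : ℝ, u x ≠ u y) ∧
    ∃ p : ℝ, (Tendsto u atBot (𝓝 p) ∧ Tendsto u atTop (𝓝 p)) ∧
      ∀ j ∈ Finset.Icc 1 3,
        Tendsto (iteratedDeriv j u) atBot (𝓝 0) ∧ Tendsto (iteratedDeriv j u) atTop (𝓝 0)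

/-- The function `(4 √30 / √11) (1 - tanh² kz) tanh kz / (1 + tanh² kz)²`. The zeros of
`cosh kz` are removable singularities at which its value is `0`; with the convention `x / 0 = 0`
the code below returns this value. -/
noncomputable def tanhProfile (k : ℝ) (z : ℂ) : ℂ :=
  ((4 * √30 / √11 : ℝ) : ℂ) *
    ((1 - Complex.tanh (k * z) ^ 2) * Complex.tanh (k * z)) /
      (1 + Complex.tanh (k * z) ^ 2) ^ 2

/-! Balancing `U''''` against `U³` shows that every pole is double with leading coefficient `c`, `c²
= -120`. Two solutions with the same leading coefficient at a common pole can differ first only at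
order 6, the one admissible root of the indicial polynomial, and equality of the first integrals
excludes that too (`eq_of_hasLeadingTerm`). So two poles of one solution with equal leading
coefficients differ by a period.

A real homoclinic solution has only imaginary periods: if `T` is a period, so is the real number `T
+ conj T`, and a periodic function with a limit at infinity is constant. Since `c` is imaginary,
reflection in the real axis exchanges the two coefficients. The poles are therefore `z₀ + iτℤ` and
`conj z₀ + iτℤ` (`exists_poles`).

Growth is controlled by Cauchy estimates alone: a solution without poles in a unit disc is bounded
at the centre by a constant depending only on `a` (`exists_bound`). By Liouville a nonconstant
solution has a pole, and, as residues vanish, `U` equals `p + c (G (z - z₀) - G (z - conj z₀))` with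
`G = z⁻²` or `G = μ² / sinh² (μ z)` (`exists_eq_of_isDoublePoleKernel`). The equation becomes a
polynomial relation between the two translated kernels. It forces `p = 0`, excludes `z⁻²`, and
determines `a`, `μ²` and the height of the poles modulo the period, up to the choice of sign
(`kernel_relations`, `sq_cos_eq_sq_sin_of_relations`).

For the converse, the profile is a constant times `sinh / cosh²` at `2kz`. The equation then reduces
to coefficient identities, and the extrema come from `|S| / (S² + 1) ≤ 1/2`, with equality exactly
at `S = ±1`. -/

/-- On a punctured neighbourhood of `z₀`, `f z = (z - z₀) ^ n * h z` with `h` analytic at `z₀` and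
`h z₀ = d`. The coefficient `d` may vanish. -/
def HasLeadingTerm (f : ℂ → ℂ) (z₀ : ℂ) (n : ℤ) (d : ℂ) : Prop :=
  ∃ h : ℂ → ℂ, AnalyticAt ℂ h z₀ ∧ h z₀ = d ∧ ∀ᶠ z in 𝓝[≠] z₀, f z = (z - z₀) ^ n * h z

/-! ### Arithmetic of leading terms. -/

namespace HasLeadingTerm

variable {f g : ℂ → ℂ} {z₀ : ℂ} {m n : ℤ} {c d : ℂ}

theorem congr (hf : HasLeadingTerm f z₀ n d) (h : ∀ᶠ z in 𝓝[≠] z₀, g z = f z) :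
    HasLeadingTerm g z₀ n d := by
  obtain ⟨u, hu, hd, he⟩ := hf
  refine ⟨u, hu, hd, ?_⟩
  filter_upwards [he, h] with z h1 h2 using h2.trans h1

theorem of_analyticAt (hf : AnalyticAt ℂ f z₀) : HasLeadingTerm f z₀ 0 (f z₀) :=
  ⟨f, hf, rfl, by simp⟩

theorem add (hf : HasLeadingTerm f z₀ n c) (hg : HasLeadingTerm g z₀ n d) :
    HasLeadingTerm (fun z => f z + g z) z₀ n (c + d) := by
  obtain ⟨u, hu, rfl, hue⟩ := hf
  obtain ⟨v, hv, rfl, hve⟩ := hg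
  refine ⟨fun z => u z + v z, hu.add hv, rfl, ?_⟩
  filter_upwards [hue, hve] with z h1 h2
  rw [h1, h2]; ring

theorem mul (hf : HasLeadingTerm f z₀ m c) (hg : HasLeadingTerm g z₀ n d) :
    HasLeadingTerm (fun z => f z * g z) z₀ (m + n) (c * d) := by
  obtain ⟨u, hu, rfl, hue⟩ := hf
  obtain ⟨v, hv, rfl, hve⟩ := hg
  refine ⟨fun z => u z * v z, hu.mul hv, rfl, ?_⟩
  filter_upwards [hue, hve, self_mem_nhdsWithin] with z h1 h2 h3
  rw [h1, h2, zpow_add₀ (sub_ne_zero.2 h3)]; ring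

theorem const_mul (a : ℂ) (hf : HasLeadingTerm f z₀ n c) :
    HasLeadingTerm (fun z => a * f z) z₀ n (a * c) := by
  obtain ⟨u, hu, rfl, hue⟩ := hf
  refine ⟨fun z => a * u z, analyticAt_const.mul hu, rfl, ?_⟩
  filter_upwards [hue] with z h1
  rw [h1]; ring

theorem sub (hf : HasLeadingTerm f z₀ n c) (hg : HasLeadingTerm g z₀ n d) :
    HasLeadingTerm (fun z => f z - g z) z₀ n (c - d) := by
  have := hf.add (hg.const_mul (-1))
  rw [neg_one_mul, ← sub_eq_add_neg] at this
  exact this.congr (by simp [sub_eq_add_neg])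

/-- In a balance of terms of different orders, the subdominant ones enter at the lowest order with
coefficient 0. This, and differentiation at `n = 0`, is why a vanishing coefficient is allowed. -/
theorem weaken (hf : HasLeadingTerm f z₀ n c) (h : m < n) : HasLeadingTerm f z₀ m 0 := by
  obtain ⟨u, hu, rfl, hue⟩ := hf
  obtain ⟨k, rfl⟩ : ∃ k : ℕ, n = m + (k + 1 : ℕ) := ⟨(n - m - 1).toNat, by push_cast; omega⟩
  refine ⟨fun z => (z - z₀) ^ (k + 1) * u z, by fun_prop, by simp, ?_⟩
  filter_upwards [hue, self_mem_nhdsWithin] with z h1 h3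
  rw [h1, zpow_add₀ (sub_ne_zero.2 h3), zpow_natCast, mul_assoc]

theorem coeff_eq_zero (hf : HasLeadingTerm f z₀ n c) (h0 : ∀ᶠ z in 𝓝[≠] z₀, f z = 0) : c = 0 := by
  obtain ⟨u, hu, rfl, hue⟩ := hf
  have h1 : ∀ᶠ z in 𝓝[≠] z₀, u z = 0 := by
    filter_upwards [hue, h0, self_mem_nhdsWithin] with z h1 h2 h3
    rw [h2] at h1
    exact (mul_eq_zero.1 h1.symm).resolve_left (zpow_ne_zero _ (sub_ne_zero.2 h3))
  have h2 : Tendsto u (𝓝[≠] z₀) (𝓝 (u z₀)) := hu.continuousAt.tendsto.mono_left nhdsWithin_le_nhds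
  exact tendsto_nhds_unique (h2.congr' h1) tendsto_const_nhds

theorem unique (hf : HasLeadingTerm f z₀ n c) (hg : HasLeadingTerm f z₀ n d) : c = d := by
  have := (hf.sub hg).coeff_eq_zero (by simp)
  exact sub_eq_zero.1 this

theorem deriv (hf : HasLeadingTerm f z₀ n c) :
    HasLeadingTerm (deriv f) z₀ (n - 1) (n * c) := by
  obtain ⟨u, hu, rfl, hue⟩ := hf
  refine ⟨fun z => n * u z + (z - z₀) * _root_.deriv u z, ?_, by simp, ?_⟩
  · have := hu.deriv
    fun_prop
  · filter_upwards [eventually_eventually_nhdsWithin.2 hue, self_mem_nhdsWithin,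
      hu.eventually_analyticAt.filter_mono nhdsWithin_le_nhds] with z h1 h2 h3
    have h2' : z - z₀ ≠ 0 := sub_ne_zero.2 h2
    have h4 : f =ᶠ[𝓝 z] fun z => (z - z₀) ^ n * u z := by
      rwa [isOpen_compl_singleton.nhdsWithin_eq h2] at h1
    rw [h4.deriv_eq]
    have h5 : HasDerivAt (fun z => (z - z₀) ^ n) (n * (z - z₀) ^ (n - 1) * 1) z :=
      (hasDerivAt_zpow n (z - z₀) (Or.inl h2')).comp (h := fun z => z - z₀) z
        ((hasDerivAt_id z).sub_const z₀)
    rw [(h5.fun_mul h3.differentiableAt.hasDerivAt).deriv, zpow_sub_one₀ h2']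
    field_simp

theorem iteratedDeriv (hf : HasLeadingTerm f z₀ n c) (k : ℕ) :
    HasLeadingTerm (iteratedDeriv k f) z₀ (n - k) ((∏ j ∈ Finset.range k, ((n : ℂ) - j)) * c) := by
  induction k with
  | zero => simpa using hf
  | succ k ih =>
    rw [iteratedDeriv_succ, Finset.prod_range_succ]
    convert ih.deriv using 1
    · push_cast; ring
    · push_cast; ring

end HasLeadingTerm

theorem MeromorphicAt.eventually_zero_or_hasLeadingTerm {f : ℂ → ℂ} {z₀ : ℂ}
    (hf : MeromorphicAt f z₀) :
    (∀ᶠ z in 𝓝[≠] z₀, f z = 0) ∨ ∃ (n : ℤ) (d : ℂ), d ≠ 0 ∧ HasLeadingTerm f z₀ n d := by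
  by_cases h : meromorphicOrderAt f z₀ = ⊤
  · exact Or.inl (meromorphicOrderAt_eq_top_iff.1 h)
  · obtain ⟨g, h1, h2, h3⟩ := (meromorphicOrderAt_ne_top_iff hf).1 h
    exact Or.inr ⟨_, g z₀, h2, g, h1, rfl, h3⟩

theorem HasLeadingTerm.cast {f : ℂ → ℂ} {z₀ c d : ℂ} {m n : ℤ} (hf : HasLeadingTerm f z₀ n c)
    (hn : n = m) (hc : c = d) : HasLeadingTerm f z₀ m d := hn ▸ hc ▸ hf

/-- The analytic factor vanishes at `z₀`, so `dslope` divides it by `z - z₀`. Iterating this peels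
off Laurent coefficients one at a time. -/
theorem HasLeadingTerm.exists_of_coeff_eq_zero {f : ℂ → ℂ} {z₀ : ℂ} {n : ℤ}
    (hf : HasLeadingTerm f z₀ n 0) : ∃ e, HasLeadingTerm f z₀ (n + 1) e := by
  obtain ⟨u, hu, h0, hue⟩ := hf
  obtain ⟨p, hp⟩ := hu
  refine ⟨_, dslope u z₀, hp.has_fpower_series_dslope_fslope.analyticAt, rfl, ?_⟩
  filter_upwards [hue, self_mem_nhdsWithin] with z h1 h3
  have h3' : z - z₀ ≠ 0 := sub_ne_zero.2 h3
  rw [h1, zpow_add_one₀ h3', dslope_of_ne _ h3, slope_def_field, h0]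
  field_simp
  ring

/-- A meromorphic function which near `z₀` agrees with an analytic function off `z₀` and is in
normal form at `z₀` is analytic at `z₀`. -/
theorem MeromorphicNFAt.analyticAt_of_eventuallyEq {f g : ℂ → ℂ} {z₀ : ℂ}
    (hf : MeromorphicNFAt f z₀) (hg : AnalyticAt ℂ g z₀) (h : ∀ᶠ z in 𝓝[≠] z₀, f z = g z) :
    AnalyticAt ℂ f z₀ := by
  rw [← hf.meromorphicOrderAt_nonneg_iff_analyticAt, meromorphicOrderAt_congr h]
  exact hg.meromorphicOrderAt_nonneg

theorem HasLeadingTerm.analyticAt {f : ℂ → ℂ} {z₀ d : ℂ} {n : ℤ} (hf : HasLeadingTerm f z₀ n d)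
    (hn : 0 ≤ n) (h : MeromorphicNFAt f z₀) : AnalyticAt ℂ f z₀ := by
  obtain ⟨u, hu, -, hue⟩ := hf
  lift n to ℕ using hn
  refine h.analyticAt_of_eventuallyEq (g := fun z => (z - z₀) ^ n * u z) (by fun_prop) ?_
  simpa using hue

/-! ### Local structure of solutions at poles. -/

/-- A solution of `U'''' + a U'' + U ^ 3 - U = 0` which is meromorphic on the plane and takes the
value `0` at its poles. -/
structure IsNFSolution (a : ℂ) (U : ℂ → ℂ) : Prop where
  nf : ∀ z, MeromorphicNFAt U z
  ode : ∀ z, AnalyticAt ℂ U z →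
    iteratedDeriv 4 U z + a * iteratedDeriv 2 U z + U z ^ 3 - U z = 0

theorem AnalyticAt.iteratedDeriv {f : ℂ → ℂ} {z : ℂ} (hf : AnalyticAt ℂ f z) (k : ℕ) :
    AnalyticAt ℂ (iteratedDeriv k f) z := by
  rw [iteratedDeriv_eq_iterate]
  exact hf.iterated_deriv k

theorem AnalyticAt.hasDerivAt_iteratedDeriv {f : ℂ → ℂ} {z : ℂ} (hf : AnalyticAt ℂ f z) (k : ℕ) :
    HasDerivAt (_root_.iteratedDeriv k f) (_root_.iteratedDeriv (k + 1) f z) z := by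
  rw [iteratedDeriv_succ]
  exact (hf.iteratedDeriv k).differentiableAt.hasDerivAt

theorem iteratedDeriv_const_mul_sub_zpow (c z₀ z : ℂ) (n : ℤ) (k : ℕ) :
    iteratedDeriv k (fun z => c * (z - z₀) ^ n) z =
      c * ((∏ i ∈ Finset.range k, ((n : ℂ) - i)) * (z - z₀) ^ (n - k)) := by
  rw [iteratedDeriv_const_mul_field, iteratedDeriv_comp_sub_const k (fun z : ℂ => z ^ n),
    iteratedDeriv_eq_iterate, iter_deriv_zpow']

namespace IsNFSolution

variable {a : ℂ} {U V : ℂ → ℂ} {z₀ c d : ℂ}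

theorem eventually_analyticAt (hU : IsNFSolution a U) (z₀ : ℂ) :
    ∀ᶠ z in 𝓝[≠] z₀, AnalyticAt ℂ U z :=
  (hU.nf z₀).meromorphicAt.eventually_analyticAt

theorem eventually_ode (hU : IsNFSolution a U) (z₀ : ℂ) : ∀ᶠ z in 𝓝[≠] z₀,
    iteratedDeriv 4 U z + a * iteratedDeriv 2 U z + U z * U z * U z - U z = 0 := by
  filter_upwards [hU.eventually_analyticAt z₀] with z hz
  rw [← hU.ode z hz]; ring

/-- Dominant balance: below order -2 the cube stands alone at lowest order, at order -1 the fourth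
derivative does, and at order -2 the two cancel exactly when `120 d + d³ = 0`. -/
theorem hasLeadingTerm_of_not_analyticAt (hU : IsNFSolution a U) (h : ¬AnalyticAt ℂ U z₀) :
    ∃ c : ℂ, c ^ 2 = -120 ∧ HasLeadingTerm U z₀ (-2) c := by
  rcases (hU.nf z₀).meromorphicAt.eventually_zero_or_hasLeadingTerm with h0 | ⟨n, d, hd, hl⟩
  · exact absurd ((hU.nf z₀).analyticAt_of_eventuallyEq (g := fun _ => 0) analyticAt_const h0) h
  have hn : n < 0 := by
    by_contra hn
    exact h (hl.analyticAt (not_lt.1 hn) (hU.nf z₀))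
  have h4 := hl.iteratedDeriv 4
  have h2 := (hl.iteratedDeriv 2).const_mul a
  have h3 := (hl.mul hl).mul hl
  simp only [Finset.prod_range_succ, Finset.prod_range_zero] at h4 h2
  push_cast at h4 h2
  rcases lt_trichotomy n (-2) with h' | rfl | h'
  · have := (((h4.weaken (m := n + n + n) (by omega)).add
      (h2.weaken (m := n + n + n) (by omega))).add h3).sub (hl.weaken (m := n + n + n) (by omega))
    have := this.coeff_eq_zero (hU.eventually_ode z₀)
    simp [hd] at this
  · have := (((h4.cast (m := -6) (by norm_num) rfl).add
      (h2.weaken (m := -6) (by omega))).add (h3.cast (by norm_num) rfl)).sub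
      (hl.weaken (m := -6) (by omega))
    have := this.coeff_eq_zero (hU.eventually_ode z₀)
    refine ⟨d, mul_left_cancel₀ hd ?_, hl⟩
    linear_combination this
  · obtain rfl : n = -1 := by omega
    have := (((h4.cast (m := -5) (by norm_num) rfl).add
      (h2.weaken (m := -5) (by omega))).add (h3.weaken (by omega))).sub
      (hl.weaken (m := -5) (by omega))
    have := this.coeff_eq_zero (hU.eventually_ode z₀)
    norm_num at this
    exact absurd this hd

/-- The residue at a pole vanishes: near a pole `U` is a multiple of `(z - z₀) ^ (-2)` up to an
analytic function. -/
theorem exists_analyticAt_of_hasLeadingTerm (hU : IsNFSolution a U)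
    (hl : HasLeadingTerm U z₀ (-2) c) (hc : c ^ 2 = -120) :
    ∃ g : ℂ → ℂ, AnalyticAt ℂ g z₀ ∧ ∀ᶠ z in 𝓝[≠] z₀, U z = c * ((z - z₀) ^ 2)⁻¹ + g z := by
  set P : ℂ → ℂ := fun z => c * (z - z₀) ^ (-2 : ℤ) with hP
  have hPl : HasLeadingTerm P z₀ (-2) c :=
    ⟨fun _ => c, analyticAt_const, rfl, by simp [hP, mul_comm]⟩
  obtain ⟨e, hW⟩ := ((hl.sub hPl).cast rfl (sub_self c)).exists_of_coeff_eq_zero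
  norm_num at hW
  -- The polar part satisfies `P'''' = -P³` because `c² = -120`. What is left has lowest order -5
  -- and is linear there in the possible residue `e`.
  have hode : ∀ᶠ z in 𝓝[≠] z₀, iteratedDeriv 4 (fun z => U z - P z) z + a * iteratedDeriv 2 U z
      + 3 * (P z * P z * (U z - P z)) + 3 * (P z * (U z - P z) * (U z - P z))
      + (U z - P z) * (U z - P z) * (U z - P z) - U z = 0 := by
    filter_upwards [hU.eventually_analyticAt z₀, self_mem_nhdsWithin] with z hz hz'
    have hz'' : z - z₀ ≠ 0 := sub_ne_zero.2 hz'
    have hPa : AnalyticAt ℂ P z := by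
      have : AnalyticAt ℂ (fun z => z - z₀) z := by fun_prop
      exact analyticAt_const.mul (this.fun_zpow hz'')
    rw [iteratedDeriv_fun_sub hz.contDiffAt hPa.contDiffAt]
    have h4 : iteratedDeriv 4 P z = -P z ^ 3 := by
      rw [hP, iteratedDeriv_const_mul_sub_zpow]
      simp only [Finset.prod_range_succ, Finset.prod_range_zero]
      rw [show (-2 : ℤ) - (4 : ℕ) = -6 by norm_num, mul_pow, ← zpow_natCast (_ ^ (-2 : ℤ)),
        ← zpow_mul]
      norm_num
      linear_combination c * ((z - z₀) ^ 6)⁻¹ * hc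
    rw [h4]
    linear_combination hU.ode z hz
  have h4 := hW.iteratedDeriv 4
  have h2 := (hl.iteratedDeriv 2).const_mul a
  simp only [Finset.prod_range_succ, Finset.prod_range_zero] at h4 h2
  push_cast at h4 h2
  have := (((((h4.cast (m := -5) (by norm_num) rfl).add (h2.weaken (by omega))).add
    ((((hPl.mul hPl).mul hW).const_mul 3).cast (by norm_num) rfl)).add
    ((((hPl.mul hW).mul hW).const_mul 3).weaken (by omega))).add
    (((hW.mul hW).mul hW).weaken (by omega))).sub (hl.weaken (by omega))
  have := this.coeff_eq_zero hode
  have he : e = 0 := by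
    -- `-336 = 24 + 3c²`, with 24 from the fourth derivative of `(z - z₀)⁻¹`.
    have h' : (-336 : ℂ) * e = 0 := by linear_combination this - 3 * e * hc
    simpa using h'
  subst he
  obtain ⟨e, g, hg, -, hge⟩ := hW.exists_of_coeff_eq_zero
  refine ⟨g, hg, ?_⟩
  filter_upwards [hge] with z h
  simp only [neg_add_cancel, zpow_zero, one_mul] at h
  have h5 : P z = c * ((z - z₀) ^ 2)⁻¹ := by
    rw [hP]; dsimp only; rw [zpow_neg]; norm_cast
  rw [← h, h5]
  ring

theorem countable_compl_analyticAt (hU : IsNFSolution a U) : {z | AnalyticAt ℂ U z}ᶜ.Countable :=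
  Meromorphic.countable_compl_analyticAt fun z => (hU.nf z).meromorphicAt

theorem isPreconnected_analyticAt (hU : IsNFSolution a U) :
    IsPreconnected {z | AnalyticAt ℂ U z} := by
  have := hU.countable_compl_analyticAt.isPathConnected_compl_of_one_lt_rank (E := ℂ)
    (by rw [Complex.rank_real_complex]; norm_num)
  rw [compl_compl] at this
  exact this.isConnected.isPreconnected

end IsNFSolution

/-! ### First integral and uniqueness from one pole. -/

/-- The first integral of `U'''' + a U'' + U ^ 3 - U = 0`. -/
noncomputable def firstIntegral (a : ℂ) (U : ℂ → ℂ) (z : ℂ) : ℂ :=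
  iteratedDeriv 3 U z * iteratedDeriv 1 U z - iteratedDeriv 2 U z ^ 2 / 2 +
    a * iteratedDeriv 1 U z ^ 2 / 2 + U z ^ 4 / 4 - U z ^ 2 / 2

namespace IsNFSolution

variable {a : ℂ} {U V : ℂ → ℂ} {z₀ c d : ℂ}

/-- The derivative is `U'` times the equation, and the set of analyticity is connected, being the
complement of a countable set in the plane. -/
theorem firstIntegral_eq (hU : IsNFSolution a U) {z w : ℂ} (hz : AnalyticAt ℂ U z)
    (hw : AnalyticAt ℂ U w) : firstIntegral a U z = firstIntegral a U w := by
  have key : ∀ z ∈ {z | AnalyticAt ℂ U z}, HasDerivAt (firstIntegral a U) 0 z := by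
    intro z hz
    have h0 : HasDerivAt U (iteratedDeriv 1 U z) z := by
      simpa only [iteratedDeriv_zero] using hz.hasDerivAt_iteratedDeriv 0
    have h1 := hz.hasDerivAt_iteratedDeriv 1
    have h2 := hz.hasDerivAt_iteratedDeriv 2
    have h3 := hz.hasDerivAt_iteratedDeriv 3
    have := ((((h3.mul h1).sub ((h2.pow 2).div_const 2)).add
      (((h1.pow 2).const_mul a).div_const 2)).add ((h0.pow 4).div_const 4)).sub
      ((h0.pow 2).div_const 2)
    refine this.congr_deriv ?_
    norm_num only [Nat.cast_ofNat, pow_one]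
    linear_combination iteratedDeriv 1 U z * hU.ode z hz
  exact (isOpen_analyticAt ℂ U).is_const_of_deriv_eq_zero hU.isPreconnected_analyticAt
    (fun z hz => (key z hz).differentiableAt.differentiableWithinAt)
    (fun z hz => (key z hz).deriv) hz hw

end IsNFSolution

/-- Identity theorem for meromorphic functions in normal form. -/
theorem eq_of_meromorphicNFAt_of_eventuallyEq {U V : ℂ → ℂ} {z₀ : ℂ}
    (hU : ∀ z, MeromorphicNFAt U z) (hV : ∀ z, MeromorphicNFAt V z)
    (h : ∀ᶠ z in 𝓝[≠] z₀, U z = V z) : U = V := by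
  have hm : Meromorphic (U - V) := fun z => (hU z).meromorphicAt.sub (hV z).meromorphicAt
  have h0 : meromorphicOrderAt (U - V) z₀ = ⊤ := by
    rw [meromorphicOrderAt_eq_top_iff]
    filter_upwards [h] with z hz using sub_eq_zero.2 hz
  funext w
  have hw : meromorphicOrderAt (U - V) w = ⊤ := by
    by_contra hw
    exact (hm.exists_meromorphicOrderAt_ne_top_iff_forall.1 ⟨w, hw⟩) z₀ h0
  rw [meromorphicOrderAt_eq_top_iff] at hw
  have : U =ᶠ[𝓝[≠] w] V := by
    filter_upwards [hw] with z hz using sub_eq_zero.1 hz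
  exact (((hU w).eventuallyEq_nhdsNE_iff_eventuallyEq_nhds (hV w)).1 this).eq_of_nhds

namespace IsNFSolution

variable {a : ℂ} {U V : ℂ → ℂ} {z₀ c d : ℂ}

/-- The difference `W` of the solutions, if nonzero, starts at some order `n ≥ -1`. The linearised
equation leaves only the resonance `n = 6`, where the equation itself gives no information; there
the difference of the first integrals has order 0 and a nonzero multiple of the coefficient of `W`.
-/
theorem eq_of_hasLeadingTerm (hU : IsNFSolution a U) (hV : IsNFSolution a V)
    (hE : ∀ z, AnalyticAt ℂ U z → AnalyticAt ℂ V z → firstIntegral a U z = firstIntegral a V z)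
    (hc : c ^ 2 = -120) (hUl : HasLeadingTerm U z₀ (-2) c) (hVl : HasLeadingTerm V z₀ (-2) c) :
    U = V := by
  refine eq_of_meromorphicNFAt_of_eventuallyEq (z₀ := z₀) hU.nf hV.nf ?_
  rcases ((hU.nf z₀).meromorphicAt.sub
    (hV.nf z₀).meromorphicAt).eventually_zero_or_hasLeadingTerm with h0 | ⟨n, d, hd, hW⟩
  · filter_upwards [h0] with z hz using sub_eq_zero.1 hz
  exfalso
  replace hW : HasLeadingTerm (fun z => U z - V z) z₀ n d := hW
  have hn : -1 ≤ n := by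
    by_contra hn
    obtain ⟨e, hW'⟩ := ((hUl.sub hVl).cast rfl (sub_self c)).exists_of_coeff_eq_zero
    exact hd (hW.unique (hW'.weaken (by omega)))
  have hc0 : c ≠ 0 := by rintro rfl; norm_num at hc
  have hWd : ∀ k, ∀ᶠ z in 𝓝[≠] z₀,
      iteratedDeriv k (fun z => U z - V z) z = iteratedDeriv k U z - iteratedDeriv k V z := by
    intro k
    filter_upwards [hU.eventually_analyticAt z₀, hV.eventually_analyticAt z₀] with z h1 h2
    rw [iteratedDeriv_fun_sub h1.contDiffAt h2.contDiffAt]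
  have h1 := hW.iteratedDeriv 1
  have h2 := hW.iteratedDeriv 2
  have h3 := hW.iteratedDeriv 3
  have h4 := hW.iteratedDeriv 4
  have hU1 := hUl.iteratedDeriv 1
  have hU2 := hUl.iteratedDeriv 2
  have hV1 := hVl.iteratedDeriv 1
  have hV2 := hVl.iteratedDeriv 2
  have hV3 := hVl.iteratedDeriv 3
  simp only [Finset.prod_range_succ, Finset.prod_range_zero] at h1 h2 h3 h4 hU1 hU2 hV1 hV2 hV3
  push_cast at h1 h2 h3 h4 hU1 hU2 hV1 hV2 hV3
  have hode : ∀ᶠ z in 𝓝[≠] z₀, iteratedDeriv 4 (fun z => U z - V z) z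
      + a * iteratedDeriv 2 (fun z => U z - V z) z
      + (U z * U z + U z * V z + V z * V z) * (U z - V z) - (U z - V z) = 0 := by
    filter_upwards [hWd 4, hWd 2, hU.eventually_analyticAt z₀, hV.eventually_analyticAt z₀]
      with z e1 e2 e3 e4
    rw [e1, e2]
    linear_combination hU.ode z e3 - hV.ode z e4
  have key := ((((h4.add ((h2.const_mul a).weaken (by omega))).add
    (((((hUl.mul hUl).add (hUl.mul hVl)).add (hVl.mul hVl)).mul hW).cast (by ring) rfl))).sub
    (hW.weaken (by omega))).coeff_eq_zero hode
  -- The indicial polynomial is `n(n-1)(n-2)(n-3) + 3c²` with `3c² = -360`.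
  have hq : ((n - 6) * (n + 3) * (n ^ 2 - 3 * n + 20) : ℂ) = 0 := by
    refine mul_left_cancel₀ hd ?_
    linear_combination key - 3 * d * hc
  have hq' : (n - 6) * (n + 3) * (n ^ 2 - 3 * n + 20) = 0 := by exact_mod_cast hq
  obtain rfl : n = 6 := by
    rcases mul_eq_zero.1 hq' with h | h
    · rcases mul_eq_zero.1 h with h | h <;> omega
    · nlinarith [sq_nonneg (2 * n - 3)]
  -- The difference of the two first integrals, arranged so that each term contains a factor `W`,
  -- `W'`, `W''` or `W'''`.
  have hEd : ∀ᶠ z in 𝓝[≠] z₀,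
      iteratedDeriv 3 (fun z => U z - V z) z * iteratedDeriv 1 U z
      + iteratedDeriv 3 V z * iteratedDeriv 1 (fun z => U z - V z) z
      + (-1 / 2) * ((iteratedDeriv 2 U z + iteratedDeriv 2 V z) *
          iteratedDeriv 2 (fun z => U z - V z) z)
      + (a / 2) * ((iteratedDeriv 1 U z + iteratedDeriv 1 V z) *
          iteratedDeriv 1 (fun z => U z - V z) z)
      + (1 / 4) * ((U z + V z) * (U z * U z + V z * V z) * (U z - V z))
      + (-1 / 2) * ((U z + V z) * (U z - V z)) = 0 := by
    filter_upwards [hWd 3, hWd 2, hWd 1, hU.eventually_analyticAt z₀, hV.eventually_analyticAt z₀]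
      with z e1 e2 e3 e4 e5
    rw [e1, e2, e3]
    have := hE z e4 e5
    simp only [firstIntegral] at this
    linear_combination this
  have key2 := ((((((h3.mul hU1).cast (m := 0) (by norm_num) rfl).add
    ((hV3.mul h1).cast (by norm_num) rfl)).add
    ((((hU2.add hV2).mul h2).const_mul (-1 / 2)).cast (by norm_num) rfl)).add
    ((((hU1.add hV1).mul h1).const_mul (a / 2)).weaken (by omega))).add
    (((((hUl.add hVl).mul ((hUl.mul hUl).add (hVl.mul hVl))).mul hW).const_mul (1 / 4)).cast
      (by norm_num) rfl)).add
    ((((hUl.add hVl).mul hW).const_mul (-1 / 2)).weaken (by omega)) |>.coeff_eq_zero hEd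
  -- `-684 = -240 - 144 - 180 - 120`: two products of third and first derivatives, the squared
  -- second derivative, and `c³ d = -120 c d` from the quartic term.
  have h684 : (-684 : ℂ) * c * d = 0 := by
    norm_num at key2
    linear_combination key2 - c * d * hc
  simp [hc0, hd] at h684

end IsNFSolution

/-! ### A priori bound away from poles. -/

namespace IsNFSolution

variable {a : ℂ} {U : ℂ → ℂ}

/-- Put `m = t⁻⁴`. If `‖U‖ < 16 m` on the whole disc, Cauchy bounds the fourth and second
derivatives at `z` by multiples of `m²`, while the equation makes them balance `‖U z‖³ ≥ m³`. This
gives `m ≤ 400 + 32‖a‖`, too small for the given `t`. -/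
theorem exists_norm_ge_of_norm_ge (hU : IsNFSolution a U) {t : ℝ} (ht : 0 < t)
    (hta : t * (401 + 32 * ‖a‖) ≤ 1) {z : ℂ} (han : ∀ w ∈ Metric.closedBall z t, AnalyticAt ℂ U w)
    (h1 : 1 ≤ ‖U z‖ * t ^ 4) :
    ∃ w ∈ Metric.closedBall z t, 1 ≤ ‖U w‖ * (t / 2) ^ 4 := by
  by_contra! hcon
  have ht1 : t ≤ 1 := by nlinarith [norm_nonneg a]
  obtain ⟨m, hm⟩ : ∃ m, m = (t ^ 4)⁻¹ := ⟨_, rfl⟩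
  have hmt : m * t ^ 4 = 1 := by rw [hm]; field_simp
  have hm1 : 1 ≤ m := by rw [hm]; exact (one_le_inv₀ (by positivity)).2 (pow_le_one₀ ht.le ht1)
  have hlt : ∀ w ∈ Metric.closedBall z t, ‖U w‖ ≤ 16 * m := by
    intro w hw
    have := hcon w hw
    have h2 : (‖U w‖ - 16 * m) * t ^ 4 ≤ 0 := by nlinarith
    have := nonpos_of_mul_nonpos_left h2 (by positivity)
    linarith
  have hd : DiffContOnCl ℂ U (Metric.ball z t) := by
    refine ⟨fun w hw => (han w (Metric.ball_subset_closedBall hw)).differentiableAt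
      |>.differentiableWithinAt, fun w hw => ?_⟩
    exact (han w (Metric.closure_ball_subset_closedBall hw)).continuousAt.continuousWithinAt
  have hs : ∀ w ∈ Metric.sphere z t, ‖U w‖ ≤ 16 * m :=
    fun w hw => hlt w (Metric.sphere_subset_closedBall hw)
  have h4 := Complex.norm_iteratedDeriv_le_of_forall_mem_sphere_norm_le 4 ht hd hs
  have h2 := Complex.norm_iteratedDeriv_le_of_forall_mem_sphere_norm_le 2 ht hd hs
  have h4' : ‖iteratedDeriv 4 U z‖ ≤ 384 * m ^ 2 := by
    refine h4.trans (le_of_eq ?_)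
    rw [div_eq_mul_inv, ← hm]
    norm_num [Nat.factorial]; ring
  have h2' : ‖iteratedDeriv 2 U z‖ ≤ 32 * m ^ 2 := by
    refine h2.trans ?_
    rw [div_le_iff₀ (by positivity)]
    have : m * t ^ 4 ≤ m * t ^ 2 := by
      refine mul_le_mul_of_nonneg_left ?_ (by linarith)
      exact pow_le_pow_of_le_one ht.le ht1 (by norm_num)
    norm_num [Nat.factorial]
    nlinarith
  have hz := Metric.mem_closedBall_self (x := z) ht.le
  have hM : m ≤ ‖U z‖ := by
    have : 0 ≤ (‖U z‖ - m) * t ^ 4 := by nlinarith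
    have := nonneg_of_mul_nonneg_left this (by positivity)
    linarith
  have hode : U z ^ 3 = U z - iteratedDeriv 4 U z - a * iteratedDeriv 2 U z := by
    linear_combination hU.ode z (han z hz)
  have h3 : ‖U z‖ ^ 3 ≤ 16 * m + 384 * m ^ 2 + ‖a‖ * (32 * m ^ 2) := by
    rw [← norm_pow, hode]
    refine (norm_sub_le _ _).trans (add_le_add ((norm_sub_le _ _).trans ?_) ?_)
    · exact add_le_add (hlt z hz) h4'
    · rw [norm_mul]
      exact mul_le_mul_of_nonneg_left h2' (norm_nonneg a)
  have h5 : m ^ 3 ≤ ‖U z‖ ^ 3 := pow_le_pow_left₀ (by linarith) hM 3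
  have h6 : m ≤ 400 + 32 * ‖a‖ := by
    have : m ^ 2 * m ≤ m ^ 2 * (400 + 32 * ‖a‖) := by nlinarith
    exact le_of_mul_le_mul_left this (by positivity)
  have h7 : t ^ 4 ≤ t := by
    simpa using pow_le_pow_of_le_one ht.le ht1 (show 1 ≤ 4 by norm_num)
  nlinarith [mul_le_mul_of_nonneg_left h7 (by linarith : (0:ℝ) ≤ m)]

/-- A solution which is analytic on a disc of radius one is bounded at the centre by a constant
which only depends on `a`. -/
theorem exists_bound (a : ℂ) : ∃ C : ℝ, ∀ U, IsNFSolution a U → ∀ z,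
    (∀ w ∈ Metric.ball z 1, AnalyticAt ℂ U w) → ‖U z‖ ≤ C := by
  set t : ℝ := (401 + 32 * ‖a‖)⁻¹ with ht
  have hpos : (0 : ℝ) < 401 + 32 * ‖a‖ := by positivity
  have ht0 : 0 < t := inv_pos.2 hpos
  have hta : t * (401 + 32 * ‖a‖) = 1 := inv_mul_cancel₀ hpos.ne'
  have ht4 : t ≤ 1 / 4 := by nlinarith [norm_nonneg a]
  refine ⟨(t ^ 4)⁻¹, fun U hU z han => ?_⟩
  by_contra! hz
  have hz1 : 1 ≤ ‖U z‖ * t ^ 4 := by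
    have := (inv_lt_iff_one_lt_mul₀ (by positivity)).1 hz
    linarith
  have hsub : ∀ w ∈ Metric.closedBall z (2 * t), AnalyticAt ℂ U w := fun w hw =>
    han w (Metric.closedBall_subset_ball (by linarith) hw)
  -- The radii `t / 2ⁿ` sum to `2t`, so the points stay in one compact disc of analyticity although
  -- `‖U‖` grows at least like `16ⁿ`.
  have step : ∀ n : ℕ, ∃ w, dist w z ≤ 2 * t * (1 - (1 / 2) ^ n) ∧
      1 ≤ ‖U w‖ * (t * (1 / 2) ^ n) ^ 4 := by
    intro n
    induction n with
    | zero => exact ⟨z, by simp, by simpa using hz1⟩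
    | succ n ih =>
      obtain ⟨w, hw1, hw2⟩ := ih
      have hp : (0 : ℝ) < (1 / 2) ^ n := by positivity
      have hp1 : ((1 : ℝ) / 2) ^ n ≤ 1 := pow_le_one₀ (by norm_num) (by norm_num)
      have hsub' : ∀ v ∈ Metric.closedBall w (t * (1 / 2) ^ n), AnalyticAt ℂ U v := by
        intro v hv
        refine hsub v ?_
        rw [Metric.mem_closedBall] at hv ⊢
        have := dist_triangle v w z
        nlinarith
      obtain ⟨v, hv1, hv2⟩ := hU.exists_norm_ge_of_norm_ge (by positivity) (by nlinarith) hsub' hw2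
      refine ⟨v, ?_, ?_⟩
      · have := dist_triangle v w z
        rw [Metric.mem_closedBall] at hv1
        rw [pow_succ]
        nlinarith
      · rwa [show t * (1 / 2) ^ (n + 1) = t * (1 / 2) ^ n / 2 by rw [pow_succ]; ring]
  have hcont : ContinuousOn U (Metric.closedBall z (2 * t)) := fun w hw =>
    (hsub w hw).continuousAt.continuousWithinAt
  obtain ⟨B, hB⟩ := (isCompact_closedBall z (2 * t)).exists_bound_of_continuousOn hcont
  obtain ⟨n, hn⟩ := exists_pow_lt_of_lt_one (show (0 : ℝ) < (|B| + 1)⁻¹ by positivity)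
    (show (1 / 2 : ℝ) < 1 by norm_num)
  obtain ⟨w, hw1, hw2⟩ := step n
  have hp : (0 : ℝ) < (1 / 2) ^ n := by positivity
  have hp1 : ((1 : ℝ) / 2) ^ n ≤ 1 := pow_le_one₀ (by norm_num) (by norm_num)
  have hwB := hB w (by rw [Metric.mem_closedBall]; nlinarith)
  have h5 : (t * (1 / 2) ^ n) ^ 4 ≤ (1 / 2) ^ n := by
    have h0 : t * (1 / 2) ^ n ≤ (1 / 2) ^ n := by nlinarith
    calc (t * (1 / 2) ^ n) ^ 4 ≤ (t * (1 / 2) ^ n) ^ 1 :=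
          pow_le_pow_of_le_one (by positivity) (by linarith) (by norm_num)
      _ ≤ _ := by simpa using h0
  have h6 : (1 / 2) ^ n * (|B| + 1) < 1 := by
    rwa [← one_div, lt_div_iff₀ (by positivity)] at hn
  have h7 : ‖U w‖ * (t * (1 / 2) ^ n) ^ 4 ≤ (|B| + 1) * (1 / 2) ^ n :=
    mul_le_mul (by linarith [le_abs_self B]) h5 (by positivity) (by positivity)
  linarith

theorem exists_eq_const_of_forall_analyticAt (hU : IsNFSolution a U)
    (h : ∀ z, AnalyticAt ℂ U z) : ∃ p, ∀ z, U z = p := by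
  obtain ⟨C, hC⟩ := exists_bound a
  have hd : Differentiable ℂ U := fun z => (h z).differentiableAt
  have hb : Bornology.IsBounded (Set.range U) := by
    rw [isBounded_iff_forall_norm_le]
    exact ⟨C, by rintro _ ⟨z, rfl⟩; exact hC U hU z fun w _ => h w⟩
  exact ⟨U 0, fun z => hd.apply_eq_apply_of_bounded hb z 0⟩

end IsNFSolution

/-! ### Reflection, periods and the set of poles. -/

theorem tendsto_add_const_nhdsNE (z₀ T : ℂ) :
    Tendsto (fun z : ℂ => z + T) (𝓝[≠] z₀) (𝓝[≠] (z₀ + T)) := by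
  refine tendsto_nhdsWithin_of_tendsto_nhds_of_eventually_within _ ?_ ?_
  · exact ((continuous_id.add continuous_const).tendsto z₀).mono_left nhdsWithin_le_nhds
  · filter_upwards [self_mem_nhdsWithin] with z hz
    simpa using hz

theorem tendsto_conj_nhdsNE (z₀ : ℂ) :
    Tendsto (starRingEnd ℂ) (𝓝[≠] z₀) (𝓝[≠] (starRingEnd ℂ z₀)) := by
  refine tendsto_nhdsWithin_of_tendsto_nhds_of_eventually_within _ ?_ ?_
  · exact (Complex.continuous_conj.tendsto z₀).mono_left nhdsWithin_le_nhds
  · filter_upwards [self_mem_nhdsWithin] with z hz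
    exact (starRingEnd ℂ).injective.ne hz

theorem AnalyticAt.conj_conj {f : ℂ → ℂ} {z : ℂ} (hf : AnalyticAt ℂ f (starRingEnd ℂ z)) :
    AnalyticAt ℂ (fun w => starRingEnd ℂ (f (starRingEnd ℂ w))) z := by
  rw [Complex.analyticAt_iff_eventually_differentiableAt] at hf ⊢
  filter_upwards [(Complex.continuous_conj.tendsto z).eventually hf] with w hw
  simpa [Function.comp_def] using hw.conj_conj

theorem MeromorphicNFAt.conj_conj {f : ℂ → ℂ} {z : ℂ} (hf : MeromorphicNFAt f (starRingEnd ℂ z)) :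
    MeromorphicNFAt (fun w => starRingEnd ℂ (f (starRingEnd ℂ w))) z := by
  rcases hf with h | ⟨n, g, h1, h2, h3⟩
  · left
    filter_upwards [(Complex.continuous_conj.tendsto z).eventually h] with w hw
    simp [hw]
  · refine Or.inr ⟨n, fun w => starRingEnd ℂ (g (starRingEnd ℂ w)), h1.conj_conj, by simpa, ?_⟩
    filter_upwards [(Complex.continuous_conj.tendsto z).eventually h3] with w hw
    simp [hw]

namespace HasLeadingTerm

variable {f : ℂ → ℂ} {z₀ c : ℂ} {n : ℤ}

theorem comp_add_const (T : ℂ) (hf : HasLeadingTerm f (z₀ + T) n c) :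
    HasLeadingTerm (fun z => f (z + T)) z₀ n c := by
  obtain ⟨u, hu, rfl, hue⟩ := hf
  refine ⟨fun z => u (z + T), hu.comp_of_eq (by fun_prop) rfl, rfl, ?_⟩
  filter_upwards [(tendsto_add_const_nhdsNE z₀ T).eventually hue] with z hz
  rw [hz]; ring_nf

theorem conj_conj (hf : HasLeadingTerm f z₀ n c) :
    HasLeadingTerm (fun z => starRingEnd ℂ (f (starRingEnd ℂ z))) (starRingEnd ℂ z₀) n
      (starRingEnd ℂ c) := by
  obtain ⟨u, hu, rfl, hue⟩ := hf
  refine ⟨fun z => starRingEnd ℂ (u (starRingEnd ℂ z)), AnalyticAt.conj_conj (by simpa), by simp, ?_⟩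
  have h := tendsto_conj_nhdsNE (starRingEnd ℂ z₀)
  rw [Complex.conj_conj] at h
  filter_upwards [h.eventually hue] with z hz
  rw [hz]; simp

end HasLeadingTerm

/-- Such a `c` is not real. Hence reflection exchanges the two possible leading coefficients. -/
theorem conj_eq_neg_of_sq_eq_neg {c : ℂ} (hc : c ^ 2 = -120) : starRingEnd ℂ c = -c := by
  have h1 : (starRingEnd ℂ c) ^ 2 = c ^ 2 := by rw [← map_pow, hc, map_neg, map_ofNat]
  rcases sq_eq_sq_iff_eq_or_eq_neg.1 h1 with h | h
  · rw [Complex.conj_eq_iff_real] at h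
    obtain ⟨r, rfl⟩ := h
    have : r ^ 2 = -120 := by exact_mod_cast hc
    nlinarith [sq_nonneg r]
  · exact h

namespace IsNFSolution

variable {a : ℂ} {U : ℂ → ℂ} {z₁ z₂ c : ℂ}

theorem comp_add_const (hU : IsNFSolution a U) (T : ℂ) :
    IsNFSolution a (fun z => U (z + T)) where
  nf z := meromorphicNFAt_comp_add_const_iff_meromorphicNFAt.2 (hU.nf (z + T))
  ode z hz := by
    have : AnalyticAt ℂ U (z + T) := by
      have h : AnalyticAt ℂ ((fun z => U (z + T)) ∘ fun w => w - T) (z + T) :=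
        hz.comp_of_eq (by fun_prop) (by ring)
      simpa [Function.comp_def] using h
    rw [iteratedDeriv_comp_add_const, iteratedDeriv_comp_add_const]
    exact hU.ode _ this

/-- The translate by `z₂ - z₁` is a solution with the same first integral and the same leading
coefficient at `z₁`, so uniqueness identifies it with `U`. -/
theorem periodic_of_hasLeadingTerm (hU : IsNFSolution a U) (hc : c ^ 2 = -120)
    (h1 : HasLeadingTerm U z₁ (-2) c) (h2 : HasLeadingTerm U z₂ (-2) c) (z : ℂ) :
    U (z + (z₂ - z₁)) = U z := by
  refine congrFun ((hU.comp_add_const (z₂ - z₁)).eq_of_hasLeadingTerm hU ?_ hc ?_ h1) z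
  · intro w hw1 hw2
    have hw3 : AnalyticAt ℂ U (w + (z₂ - z₁)) := by
      have h : AnalyticAt ℂ ((fun z => U (z + (z₂ - z₁))) ∘ fun w => w - (z₂ - z₁))
          (w + (z₂ - z₁)) := hw1.comp_of_eq (by fun_prop) (by ring)
      simpa [Function.comp_def] using h
    rw [← hU.firstIntegral_eq hw3 hw2]
    simp only [firstIntegral, iteratedDeriv_comp_add_const]
  · exact HasLeadingTerm.comp_add_const _ (by simpa)

/-- Schwarz reflection: both sides agree on the real axis near 0, then everywhere by the identity
theorem. -/
theorem apply_conj (hU : IsNFSolution a U) (hr : IsRealOnReals U) (z : ℂ) :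
    starRingEnd ℂ (U (starRingEnd ℂ z)) = U z := by
  refine congrFun (eq_of_meromorphicNFAt_of_eventuallyEq (z₀ := 0)
    (U := fun z => starRingEnd ℂ (U (starRingEnd ℂ z))) (fun z => (hU.nf _).conj_conj) hU.nf ?_) z
  have h0 : AnalyticAt ℂ U 0 := by simpa using (hr 0).1
  have h1 : AnalyticAt ℂ (fun z => starRingEnd ℂ (U (starRingEnd ℂ z))) 0 :=
    AnalyticAt.conj_conj (by simpa)
  have h2 := (h1.frequently_eq_iff_eventually_eq h0).1 ?_
  · exact h2.filter_mono nhdsWithin_le_nhds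
  · have ht : Tendsto (fun x : ℝ => (x : ℂ)) (𝓝[≠] 0) (𝓝[≠] 0) := by
      refine tendsto_nhdsWithin_of_tendsto_nhds_of_eventually_within _ ?_ ?_
      · exact (Complex.continuous_ofReal.tendsto' 0 0 (by simp)).mono_left nhdsWithin_le_nhds
      · filter_upwards [self_mem_nhdsWithin] with x hx
        simpa using hx
    refine ht.frequently (Eventually.frequently (Eventually.of_forall fun x => ?_))
    rw [Complex.conj_ofReal, Complex.conj_eq_iff_im]
    exact (hr x).2

/-- A homoclinic solution has only imaginary periods. -/
theorem re_eq_zero_of_periodic (hU : IsNFSolution a U) (hr : IsRealOnReals U)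
    (hh : IsHomoclinic (realTrace U)) {T : ℂ} (hT : ∀ z, U (z + T) = U z) : T.re = 0 := by
  -- By reflection `conj T` is a period too, hence so is `T + conj T = 2 Re T`.
  have hT' : ∀ z, U (z + (2 * T.re : ℝ)) = U z := by
    intro z
    have h1 : U (z + starRingEnd ℂ T) = U z := by
      rw [← hU.apply_conj hr (z + _), ← hU.apply_conj hr z, map_add, Complex.conj_conj, hT]
    rw [← Complex.add_conj, ← add_assoc]
    have h2 : U (z + T + starRingEnd ℂ T) = U (z + starRingEnd ℂ T) := by
      rw [add_right_comm]; exact hT _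
    rw [h2, h1]
  have hper : Function.Periodic (realTrace U) (2 * T.re) := by
    intro x
    simp only [realTrace, Complex.ofReal_add, hT']
  by_contra hne
  obtain ⟨⟨x, y, hxy⟩, p, ⟨-, hp⟩, -⟩ := hh
  have hper' : Function.Periodic (realTrace U) |2 * T.re| := by
    rcases abs_choice (2 * T.re) with h | h <;> rw [h]
    exacts [hper, hper.neg]
  have hconst : ∀ x, realTrace U x = p := by
    intro x
    have h1 : Tendsto (fun n : ℕ => x + n * |2 * T.re|) atTop atTop :=
      tendsto_atTop_add_const_left _ _
        (tendsto_natCast_atTop_atTop.atTop_mul_const (by simpa using hne))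
    have h2 := hp.comp h1
    refine tendsto_nhds_unique (tendsto_const_nhds.congr fun n => ?_) h2
    simp only [Function.comp_apply]
    exact ((hper'.nat_mul n) x).symm
  exact hxy (by rw [hconst, hconst])

/-- The imaginary periods of a function. -/
def imaginaryPeriods (U : ℂ → ℂ) : AddSubgroup ℝ where
  carrier := {s | ∀ z, U (z + s * Complex.I) = U z}
  zero_mem' z := by simp
  add_mem' {s t} hs ht z := by
    rw [Complex.ofReal_add, add_mul, ← add_assoc, ht, hs]
  neg_mem' {s} hs z := by
    rw [← hs]; simp

/-- The poles of a real homoclinic solution form two conjugate arithmetic progressions. -/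
theorem exists_poles (hU : IsNFSolution a U) (hr : IsRealOnReals U)
    (hh : IsHomoclinic (realTrace U)) :
    ∃ (z₀ c : ℂ) (τ : ℝ), c ^ 2 = -120 ∧ HasLeadingTerm U z₀ (-2) c ∧
      HasLeadingTerm U (starRingEnd ℂ z₀) (-2) (-c) ∧
      (∀ (n : ℤ) z, U (z + n * (τ * Complex.I)) = U z) ∧
      (∀ n : ℤ, starRingEnd ℂ z₀ - z₀ ≠ n * (τ * Complex.I)) ∧
      ∀ z, ¬AnalyticAt ℂ U z → ∃ n : ℤ,
        z = z₀ + n * (τ * Complex.I) ∨ z = starRingEnd ℂ z₀ + n * (τ * Complex.I) := by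
  obtain ⟨z₀, hz₀⟩ : ∃ z₀, ¬AnalyticAt ℂ U z₀ := by
    by_contra! h
    obtain ⟨p, hp⟩ := hU.exists_eq_const_of_forall_analyticAt h
    obtain ⟨⟨x, y, hxy⟩, -⟩ := hh
    simp [realTrace, hp] at hxy
  obtain ⟨c, hc, hl⟩ := hU.hasLeadingTerm_of_not_analyticAt hz₀
  have hl' : HasLeadingTerm U (starRingEnd ℂ z₀) (-2) (-c) := by
    rw [← conj_eq_neg_of_sq_eq_neg hc]
    exact hl.conj_conj.congr (Eventually.of_forall fun z => (hU.apply_conj hr z).symm)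
  have him : ∀ T, (∀ z, U (z + T) = U z) → ∃ s ∈ imaginaryPeriods U, T = s * Complex.I := by
    intro T hT
    have hT' : T = T.im * Complex.I := by
      apply Complex.ext <;> simp [hU.re_eq_zero_of_periodic hr hh hT]
    exact ⟨T.im, fun z => by rw [← hT', hT], hT'⟩
  -- A dense group would contain arbitrarily small `s > 0` with `U` analytic at `z₀ + s i`, poles
  -- being isolated; periodicity would carry analyticity back to `z₀`. The generator `τ` may be 0,
  -- when there is a single pair of poles.
  have hcyc : ∃ τ, imaginaryPeriods U = AddSubgroup.closure {τ} := by
    refine (AddSubgroup.dense_or_cyclic _).resolve_left fun hd => ?_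
    have ht : Tendsto (fun s : ℝ => z₀ + s * Complex.I) (𝓝[≠] 0) (𝓝[≠] z₀) := by
      refine tendsto_nhdsWithin_of_tendsto_nhds_of_eventually_within _ ?_ ?_
      · refine Tendsto.mono_left ?_ nhdsWithin_le_nhds
        exact Continuous.tendsto' (by fun_prop) _ _ (by simp)
      · filter_upwards [self_mem_nhdsWithin] with s hs
        simpa using hs
    have h1 := ht.eventually (hU.eventually_analyticAt z₀)
    rw [eventually_nhdsWithin_iff, Metric.eventually_nhds_iff] at h1
    obtain ⟨ε, hε, h1⟩ := h1
    obtain ⟨s, hs, hs'⟩ := hd.exists_mem_open (isOpen_Ioo (a := (0 : ℝ)) (b := ε))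
      ⟨ε / 2, by constructor <;> linarith⟩
    have h2 := h1 (y := s) (by rw [Real.dist_eq, sub_zero, abs_of_pos hs'.1]; exact hs'.2) hs'.1.ne'
    refine hz₀ ?_
    have h3 : AnalyticAt ℂ (U ∘ fun w => w + s * Complex.I) z₀ := h2.comp_of_eq (by fun_prop) rfl
    have h4 : (U ∘ fun w => w + s * Complex.I) = U := funext hs
    rwa [h4] at h3
  obtain ⟨τ, hτ⟩ := hcyc
  have hmem : ∀ s ∈ imaginaryPeriods U, ∃ n : ℤ, (s : ℂ) * Complex.I = n * (τ * Complex.I) := by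
    intro s hs
    rw [hτ, AddSubgroup.mem_closure_singleton] at hs
    obtain ⟨n, rfl⟩ := hs
    exact ⟨n, by simp; ring⟩
  have hc0 : c ≠ 0 := by rintro rfl; norm_num at hc
  have hper : ∀ (n : ℤ) z, U (z + n * (τ * Complex.I)) = U z := by
    intro n z
    have h1 : n • τ ∈ imaginaryPeriods U := by
      rw [hτ]
      exact zsmul_mem (AddSubgroup.mem_closure_singleton_self τ) n
    have h2 := h1 z
    rw [← h2]; simp; ring_nf
  refine ⟨z₀, c, τ, hc, hl, hl', hper, ?_, ?_⟩
  -- Otherwise `z₀` and its conjugate would be equivalent poles, forcing `c = -c`.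
  · intro n hn
    have h1 : HasLeadingTerm (fun z => U (z + n * (τ * Complex.I))) z₀ (-2) (-c) := by
      refine HasLeadingTerm.comp_add_const _ ?_
      rwa [← hn, add_sub_cancel]
    simp only [hper] at h1
    have h2 := hl.unique h1
    exact hc0 (by linear_combination h2 / 2)
  · intro z hz
    obtain ⟨d, hd, hld⟩ := hU.hasLeadingTerm_of_not_analyticAt hz
    rcases sq_eq_sq_iff_eq_or_eq_neg.1 (hd.trans hc.symm) with rfl | rfl
    · obtain ⟨s, hs, hs'⟩ := him _ (hU.periodic_of_hasLeadingTerm hc hl hld)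
      obtain ⟨n, hn⟩ := hmem s hs
      exact ⟨n, Or.inl (by rw [← hn, ← hs']; ring)⟩
    · obtain ⟨s, hs, hs'⟩ := him _ (hU.periodic_of_hasLeadingTerm hd hl' hld)
      obtain ⟨n, hn⟩ := hmem s hs
      exact ⟨n, Or.inr (by rw [← hn, ← hs']; ring)⟩

end IsNFSolution

/-! ### Kernels with double poles. -/

/-- The properties of the functions `z ^ (-2)` (for `τ = μ = 0`) and `μ ^ 2 / sinh (μ z) ^ 2` (for
`μ τ = π`) from which double poles along `τ i ℤ` are built. -/
structure IsDoublePoleKernel (τ μ : ℝ) (G : ℂ → ℂ) : Prop where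
  periodic : ∀ (n : ℤ) z, G (z + n * (τ * Complex.I)) = G z
  even : ∀ z, G (-z) = G z
  analyticAt : ∀ z, (∀ n : ℤ, z ≠ n * (τ * Complex.I)) → AnalyticAt ℂ G z
  iteratedDeriv_two : ∀ z, (∀ n : ℤ, z ≠ n * (τ * Complex.I)) →
    iteratedDeriv 2 G z = 6 * G z ^ 2 + 4 * μ ^ 2 * G z
  iteratedDeriv_four : ∀ z, (∀ n : ℤ, z ≠ n * (τ * Complex.I)) →
    iteratedDeriv 4 G z = 120 * G z ^ 3 + 120 * μ ^ 2 * G z ^ 2 + 16 * μ ^ 4 * G z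
  polar : ∃ g, AnalyticAt ℂ g 0 ∧ ∀ᶠ z in 𝓝[≠] 0, G z = (z ^ 2)⁻¹ + g z
  norm_le : ∀ z : ℂ, z.re ≠ 0 → ‖G z‖ ≤ (z.re ^ 2)⁻¹
  -- Prepares Liouville: each point is, modulo periods, in a fixed compact disc, or else the kernel
  -- is small and the lattice is at distance at least 1, as the a priori bound requires.
  near_or_far : ∃ R : ℝ, ∀ z, ∃ n : ℤ, ‖z + n * (τ * Complex.I)‖ ≤ R ∨
    ‖G z‖ ≤ 1 ∧ ∀ m : ℤ, 1 ≤ ‖z - m * (τ * Complex.I)‖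
  inj : ∀ z w, (∀ n : ℤ, z ≠ n * (τ * Complex.I)) → (∀ n : ℤ, w ≠ n * (τ * Complex.I)) →
    G z = G w → ∃ n : ℤ, z - w = n * (τ * Complex.I) ∨ z + w = n * (τ * Complex.I)

theorem Set.EqOn.iteratedDeriv_succ_of_hasDerivAt {𝕜 : Type*} [NontriviallyNormedField 𝕜]
    {s : Set 𝕜} (hs : IsOpen s) {k : ℕ} {F f g : 𝕜 → 𝕜} (h1 : Set.EqOn (iteratedDeriv k F) f s)
    (h2 : ∀ z ∈ s, HasDerivAt f (g z) z) : Set.EqOn (iteratedDeriv (k + 1) F) g s := by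
  intro z hz
  rw [iteratedDeriv_succ, (h1.eventuallyEq_of_mem (hs.mem_nhds hz)).deriv_eq, (h2 z hz).deriv]

/-- The derivatives of order two and four of a function with `G' = H`,
`H' = 6 G ^ 2 + 4 μ ^ 2 G`, `H ^ 2 = 4 G ^ 3 + 4 μ ^ 2 G ^ 2`. -/
theorem iteratedDeriv_of_hasDerivAt {μ : ℂ} {G H : ℂ → ℂ} {s : Set ℂ} (hs : IsOpen s)
    (hG : ∀ z ∈ s, HasDerivAt G (H z) z)
    (hH : ∀ z ∈ s, HasDerivAt H (6 * G z ^ 2 + 4 * μ ^ 2 * G z) z)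
    (hGH : ∀ z ∈ s, H z ^ 2 = 4 * G z ^ 3 + 4 * μ ^ 2 * G z ^ 2) {z : ℂ} (hz : z ∈ s) :
    iteratedDeriv 2 G z = 6 * G z ^ 2 + 4 * μ ^ 2 * G z ∧
    iteratedDeriv 4 G z = 120 * G z ^ 3 + 120 * μ ^ 2 * G z ^ 2 + 16 * μ ^ 4 * G z := by
  have e0 : Set.EqOn (iteratedDeriv 0 G) G s := fun z _ => by simp
  have e1 := e0.iteratedDeriv_succ_of_hasDerivAt hs hG
  have e2 := e1.iteratedDeriv_succ_of_hasDerivAt hs hH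
  have e3 : Set.EqOn (iteratedDeriv 3 G) (fun z => 12 * (G z * H z) + 4 * μ ^ 2 * H z) s := by
    refine e2.iteratedDeriv_succ_of_hasDerivAt hs fun z hz => ?_
    refine ((((hG z hz).fun_pow 2).const_mul 6).fun_add ((hG z hz).const_mul _)).congr_deriv ?_
    norm_num; ring
  have e4 : Set.EqOn (iteratedDeriv 4 G)
      (fun z => 120 * G z ^ 3 + 120 * μ ^ 2 * G z ^ 2 + 16 * μ ^ 4 * G z) s := by
    refine e3.iteratedDeriv_succ_of_hasDerivAt hs fun z hz => ?_
    refine ((((hG z hz).fun_mul (hH z hz)).const_mul 12).fun_add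
      ((hH z hz).const_mul _)).congr_deriv ?_
    linear_combination 12 * hGH z hz
  exact ⟨e2 hz, e4 hz⟩

theorem isDoublePoleKernel_inv_sq : IsDoublePoleKernel 0 0 (fun z => (z ^ 2)⁻¹) := by
  have hne : ∀ z : ℂ, (∀ n : ℤ, z ≠ n * ((0 : ℝ) * Complex.I)) → z ≠ 0 := by
    intro z hz h; exact hz 0 (by simp [h])
  have hd : ∀ z : ℂ, z ∈ ({0}ᶜ : Set ℂ) → _ := fun z hz =>
    iteratedDeriv_of_hasDerivAt (μ := 0) (G := fun z : ℂ => (z ^ 2)⁻¹) (H := fun z => -2 * (z ^ 3)⁻¹)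
      isOpen_compl_singleton (fun w hw => by
        have hw : w ≠ 0 := hw
        refine ((hasDerivAt_pow 2 w).fun_inv (by positivity)).congr_deriv ?_
        field_simp; norm_num; ring) (fun w hw => by
        have hw : w ≠ 0 := hw
        refine (((hasDerivAt_pow 3 w).fun_inv (by positivity)).const_mul (-2)).congr_deriv ?_
        field_simp; norm_num; ring) (fun w hw => by
        have hw : w ≠ 0 := hw
        field_simp; norm_num) hz
  have hnorm : ∀ z : ℂ, z.re ≠ 0 → ‖(z ^ 2)⁻¹‖ ≤ (z.re ^ 2)⁻¹ := by
    intro z hz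
    rw [norm_inv, norm_pow]
    refine inv_anti₀ (by positivity) ?_
    rw [← sq_abs]
    exact pow_le_pow_left₀ (abs_nonneg _) (Complex.abs_re_le_norm z) 2
  constructor
  · simp
  · simp
  · intro z hz
    have := hne z hz
    exact AnalyticAt.fun_inv (by fun_prop) (by positivity)
  · intro z hz
    simpa using (hd z (hne z hz)).1
  · intro z hz
    simpa using (hd z (hne z hz)).2
  · exact ⟨fun _ => 0, analyticAt_const, by simp⟩
  · exact hnorm
  · refine ⟨1, fun z => ⟨0, ?_⟩⟩
    rcases le_total ‖z‖ 1 with h | h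
    · left; simpa
    · right
      refine ⟨?_, by simpa⟩
      rw [norm_inv, norm_pow]
      exact inv_le_one_of_one_le₀ (one_le_pow₀ h)
  · intro z w hz hw h
    have h1 := inv_injective h
    refine ⟨0, ?_⟩
    rcases sq_eq_sq_iff_eq_or_eq_neg.1 h1 with h | h
    · left; simp [h]
    · right; simp [h]

theorem Real.abs_self_le_abs_sinh (x : ℝ) : |x| ≤ |Real.sinh x| := by
  rcases le_total 0 x with h | h
  · have := Real.self_le_sinh_iff.2 h
    rwa [abs_of_nonneg h, abs_of_nonneg (h.trans this)]
  · have := Real.sinh_le_self_iff.2 h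
    rw [abs_of_nonpos h, abs_of_nonpos (this.trans h)]
    linarith

/-- `|sinh (x + iy)|² = sinh² x + sin² y`, and `|sinh x| ≥ |x|`. -/
theorem sq_re_le_norm_sinh_sq (z : ℂ) : z.re ^ 2 ≤ ‖Complex.sinh z ^ 2‖ := by
  have h1 : ‖Complex.sinh z‖ ^ 2 = Real.sinh z.re ^ 2 + Real.sin z.im ^ 2 := by
    rw [← Complex.normSq_eq_norm_sq, Complex.normSq_apply]
    conv_lhs => rw [← Complex.re_add_im z]
    rw [Complex.sinh_add, Complex.sinh_mul_I, Complex.cosh_mul_I]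
    simp only [← Complex.ofReal_sinh, ← Complex.ofReal_cosh, ← Complex.ofReal_sin,
      ← Complex.ofReal_cos, Complex.add_re, Complex.add_im, Complex.mul_re, Complex.mul_im,
      Complex.ofReal_re, Complex.ofReal_im, Complex.I_re, Complex.I_im]
    have h2 := Real.cosh_sq z.re
    have h3 := Real.sin_sq_add_cos_sq z.im
    linear_combination Real.sin z.im ^ 2 * h2 + (Real.sinh z.re ^ 2) * h3
  rw [norm_pow, h1]
  have := sq_le_sq.2 (Real.abs_self_le_abs_sinh z.re)
  nlinarith [sq_nonneg (Real.sin z.im)]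

theorem Complex.sinh_eq_zero_iff_exists_int (z : ℂ) :
    Complex.sinh z = 0 ↔ ∃ n : ℤ, z = n * (Real.pi * Complex.I) := by
  have h1 : Complex.sinh z = -(Complex.sin (z * Complex.I) * Complex.I) := by
    rw [Complex.sin_mul_I, mul_assoc, Complex.I_mul_I]; ring
  rw [h1, neg_eq_zero, mul_eq_zero, or_iff_left Complex.I_ne_zero, Complex.sin_eq_zero_iff]
  constructor
  · rintro ⟨n, hn⟩
    refine ⟨-n, ?_⟩
    push_cast
    linear_combination -Complex.I * hn + z * Complex.I_mul_I
  · rintro ⟨n, hn⟩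
    refine ⟨-n, ?_⟩
    push_cast
    rw [hn]
    linear_combination n * Real.pi * Complex.I_mul_I

/-- Comparing derivatives at 0 gives `sinh z = z + z³ u(z)`; the missing quadratic term is what
removes the `1/z` term from the inverse square. -/
theorem exists_analyticAt_inv_sinh_sq :
    ∃ g, AnalyticAt ℂ g 0 ∧ ∀ᶠ z in 𝓝[≠] (0 : ℂ), (Complex.sinh z ^ 2)⁻¹ = (z ^ 2)⁻¹ + g z := by
  have hd0 : ∀ z, HasDerivAt (fun z => Complex.sinh z - z) (Complex.cosh z - 1) z := fun z =>
    (Complex.hasDerivAt_sinh z).sub (hasDerivAt_id z)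
  have hd1 : ∀ z, HasDerivAt (fun z => Complex.cosh z - 1) (Complex.sinh z) z := fun z =>
    (Complex.hasDerivAt_cosh z).sub_const 1
  have ha0 : AnalyticAt ℂ (fun z => Complex.sinh z - z) 0 :=
    Differentiable.analyticAt (fun z => (hd0 z).differentiableAt) 0
  have ha1 : AnalyticAt ℂ (fun z => Complex.cosh z - 1) 0 :=
    Differentiable.analyticAt (fun z => (hd1 z).differentiableAt) 0
  have ha2 : AnalyticAt ℂ Complex.sinh 0 := Complex.differentiable_sinh.analyticAt 0
  have e1 : deriv (fun z => Complex.sinh z - z) = fun z => Complex.cosh z - 1 :=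
    funext fun z => (hd0 z).deriv
  have e2 : deriv (fun z => Complex.cosh z - 1) = Complex.sinh := funext fun z => (hd1 z).deriv
  obtain ⟨d, h1⟩ := ((HasLeadingTerm.of_analyticAt ha0).cast rfl (d := 0)
    (by simp)).exists_of_coeff_eq_zero
  have h1' := h1.deriv
  rw [e1] at h1'
  have hd : d = 0 := by
    have := (HasLeadingTerm.of_analyticAt ha1).unique h1'
    simpa using this.symm
  subst hd
  obtain ⟨d, h2⟩ := h1.exists_of_coeff_eq_zero
  have h2' := h2.deriv.deriv
  rw [e1, e2] at h2'
  have hd : d = 0 := by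
    have := (HasLeadingTerm.of_analyticAt ha2).unique h2'
    norm_num at this
    exact this
  subst hd
  obtain ⟨-, u, hu, -, hue⟩ := h2.exists_of_coeff_eq_zero
  have hne : ∀ᶠ z in 𝓝 (0 : ℂ), 1 + z ^ 2 * u z ≠ 0 := by
    have : ContinuousAt (fun z => 1 + z ^ 2 * u z) 0 := by
      have := hu.continuousAt
      fun_prop
    exact this.eventually_ne (by simp)
  refine ⟨fun z => -(2 * u z + z ^ 2 * u z ^ 2) / (1 + z ^ 2 * u z) ^ 2, ?_, ?_⟩
  · exact AnalyticAt.fun_div (by fun_prop) (by fun_prop) (by simp)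
  · filter_upwards [hue, self_mem_nhdsWithin, hne.filter_mono nhdsWithin_le_nhds] with z h3 h4 h5
    have h4 : z ≠ 0 := h4
    have h6 : Complex.sinh z = z * (1 + z ^ 2 * u z) := by
      norm_num at h3
      linear_combination h3
    rw [h6]
    field_simp
    ring

/-- This factorisation yields both the periodicity of the kernel and its injectivity modulo sign and
lattice. -/
theorem sinh_sq_sub_sinh_sq (z w : ℂ) :
    Complex.sinh z ^ 2 - Complex.sinh w ^ 2 = Complex.sinh (z + w) * Complex.sinh (z - w) := by
  rw [Complex.sinh_add, Complex.sinh_sub]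
  linear_combination Complex.sinh w ^ 2 * Complex.cosh_sq z - Complex.sinh z ^ 2 * Complex.cosh_sq w

theorem isDoublePoleKernel_inv_sinh_sq {τ μ : ℝ} (hμτ : μ * τ = Real.pi) :
    IsDoublePoleKernel τ μ (fun z => μ ^ 2 * (Complex.sinh (μ * z) ^ 2)⁻¹) := by
  have hμ : (μ : ℂ) ≠ 0 := by
    rintro h
    rw [Complex.ofReal_eq_zero] at h
    rw [h, zero_mul] at hμτ
    exact Real.pi_ne_zero hμτ.symm
  have hτ : τ ≠ 0 := by
    rintro rfl
    rw [mul_zero] at hμτ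
    exact Real.pi_ne_zero hμτ.symm
  have hμτ' : (μ : ℂ) * τ = Real.pi := by exact_mod_cast hμτ
  have hzero : ∀ z : ℂ, Complex.sinh (μ * z) = 0 ↔ ∃ n : ℤ, z = n * (τ * Complex.I) := by
    intro z
    rw [Complex.sinh_eq_zero_iff_exists_int, ← hμτ']
    refine exists_congr fun n => ⟨fun h => mul_left_cancel₀ hμ ?_, fun h => ?_⟩
    · rw [h]; ring
    · rw [h]; ring
  have hne : ∀ z : ℂ, (∀ n : ℤ, z ≠ n * (τ * Complex.I)) → Complex.sinh (μ * z) ≠ 0 := by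
    intro z hz h
    obtain ⟨n, hn⟩ := (hzero z).1 h
    exact hz n hn
  have hS : ∀ z : ℂ, HasDerivAt (fun z : ℂ => Complex.sinh (μ * z)) (Complex.cosh (μ * z) * μ) z := by
    intro z
    simpa using ((hasDerivAt_id z).const_mul (μ : ℂ)).csinh
  have hC : ∀ z : ℂ, HasDerivAt (fun z : ℂ => Complex.cosh (μ * z)) (Complex.sinh (μ * z) * μ) z := by
    intro z
    simpa using ((hasDerivAt_id z).const_mul (μ : ℂ)).ccosh
  have hopen : IsOpen {z : ℂ | Complex.sinh (μ * z) ≠ 0} := by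
    refine isOpen_ne_fun ?_ continuous_const
    exact continuous_iff_continuousAt.2 fun z => (hS z).continuousAt
  have hd : ∀ z : ℂ, z ∈ {z : ℂ | Complex.sinh (μ * z) ≠ 0} → _ := fun z hz =>
    iteratedDeriv_of_hasDerivAt (μ := μ) (G := fun z : ℂ => μ ^ 2 * (Complex.sinh (μ * z) ^ 2)⁻¹)
      (H := fun z => -2 * μ ^ 3 * (Complex.cosh (μ * z) * (Complex.sinh (μ * z) ^ 3)⁻¹)) hopen
      (fun w hw => by
        have hw : Complex.sinh (μ * w) ≠ 0 := hw
        refine ((((hS w).fun_pow 2).fun_inv (by positivity)).const_mul _).congr_deriv ?_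
        field_simp; norm_num; ring)
      (fun w hw => by
        have hw : Complex.sinh (μ * w) ≠ 0 := hw
        refine (((hC w).fun_mul (((hS w).fun_pow 3).fun_inv (by positivity))).const_mul
          _).congr_deriv ?_
        have h2 := Complex.cosh_sq (μ * w)
        field_simp
        norm_num
        linear_combination 6 * Complex.sinh (μ * w) ^ 2 * h2)
      (fun w hw => by
        have hw : Complex.sinh (μ * w) ≠ 0 := hw
        have h2 := Complex.cosh_sq (μ * w)
        field_simp
        linear_combination 4 * h2) hz
  have hnorm : ∀ z : ℂ, z.re ≠ 0 → ‖(μ : ℂ) ^ 2 * (Complex.sinh (μ * z) ^ 2)⁻¹‖ ≤ (z.re ^ 2)⁻¹ := by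
    intro z hz
    have h1 := sq_re_le_norm_sinh_sq (μ * z)
    have hμ' : μ ≠ 0 := by exact_mod_cast hμ
    rw [Complex.re_ofReal_mul, mul_pow] at h1
    rw [norm_mul, norm_inv, norm_pow, Complex.norm_real, Real.norm_eq_abs, sq_abs]
    have h2 : (‖Complex.sinh (μ * z) ^ 2‖)⁻¹ ≤ (μ ^ 2 * z.re ^ 2)⁻¹ :=
      inv_anti₀ (by positivity) h1
    calc μ ^ 2 * (‖Complex.sinh (μ * z) ^ 2‖)⁻¹ ≤ μ ^ 2 * (μ ^ 2 * z.re ^ 2)⁻¹ := by gcongr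
      _ = _ := by field_simp
  constructor
  · intro n z
    have h1 : Complex.sinh (μ * (z + n * (τ * Complex.I))) ^ 2 - Complex.sinh (μ * z) ^ 2 = 0 := by
      rw [sinh_sq_sub_sinh_sq, ← mul_sub, add_sub_cancel_left, (hzero _).2 ⟨n, rfl⟩, mul_zero]
    simp only [sub_eq_zero.1 h1]
  · intro z
    simp
  · intro z hz
    have h1 := hne z hz
    have h2 : AnalyticAt ℂ (fun z : ℂ => Complex.sinh (μ * z)) z :=
      Differentiable.analyticAt (fun z => (hS z).differentiableAt) z
    exact analyticAt_const.mul ((h2.fun_pow 2).fun_inv (by positivity))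
  · exact fun z hz => (hd z (hne z hz)).1
  · exact fun z hz => (hd z (hne z hz)).2
  · obtain ⟨g, hg, hge⟩ := exists_analyticAt_inv_sinh_sq
    refine ⟨fun z => μ ^ 2 * g (μ * z), ?_, ?_⟩
    · exact analyticAt_const.mul (hg.comp_of_eq (f := fun z : ℂ => μ * z) (by fun_prop) (by simp))
    · have ht : Tendsto (fun z : ℂ => μ * z) (𝓝[≠] 0) (𝓝[≠] 0) := by
        refine tendsto_nhdsWithin_of_tendsto_nhds_of_eventually_within _ ?_ ?_
        · exact (Continuous.tendsto' (by fun_prop) _ _ (by simp)).mono_left nhdsWithin_le_nhds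
        · filter_upwards [self_mem_nhdsWithin] with z hz
          exact mul_ne_zero hμ hz
      filter_upwards [ht.eventually hge, self_mem_nhdsWithin] with z hz hz0
      have hz0 : z ≠ 0 := hz0
      rw [hz]
      field_simp
  · exact hnorm
  -- Translation by the nearest lattice point brings the imaginary part to at most `|τ| / 2` in
  -- absolute value.
  · refine ⟨1 + |τ|, fun z => ⟨-round (z.im / τ), ?_⟩⟩
    rcases le_total |z.re| 1 with h | h
    · left
      refine (Complex.norm_le_abs_re_add_abs_im _).trans (add_le_add ?_ ?_)
      · simpa using h
      · have h1 := abs_sub_round (z.im / τ)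
        have h2 : (z + (-round (z.im / τ) : ℤ) * (τ * Complex.I)).im =
            (z.im / τ - round (z.im / τ)) * τ := by
          simp
          field_simp
          ring
        rw [h2, abs_mul]
        nlinarith [abs_nonneg τ]
    · right
      have h0 : z.re ≠ 0 := by
        rintro h0
        rw [h0] at h
        norm_num at h
      refine ⟨(hnorm z h0).trans (inv_le_one_of_one_le₀ ?_), fun m => ?_⟩
      · rw [← sq_abs]; exact one_le_pow₀ h
      · refine h.trans ?_
        have := Complex.abs_re_le_norm (z - m * (τ * Complex.I))
        simpa using this
  · intro z w hz hw h
    have h1 := inv_injective (mul_left_cancel₀ (pow_ne_zero 2 hμ) h)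
    rw [← sub_eq_zero, sinh_sq_sub_sinh_sq, ← mul_add, ← mul_sub, mul_eq_zero, hzero, hzero] at h1
    rcases h1 with ⟨n, hn⟩ | ⟨n, hn⟩
    · exact ⟨n, Or.inr hn⟩
    · exact ⟨n, Or.inl hn⟩

/-! ### Representation of a solution by two kernels. -/

theorem Meromorphic.exists_meromorphicNFAt {f : ℂ → ℂ} (hf : Meromorphic f) :
    ∃ F : ℂ → ℂ, (∀ z, MeromorphicNFAt F z) ∧ (∀ z, ∀ᶠ w in 𝓝[≠] z, F w = f w) ∧
      ∀ z, AnalyticAt ℂ f z → F =ᶠ[𝓝 z] f := by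
  have hf' : MeromorphicOn f Set.univ := fun z _ => hf z
  have h1 : ∀ z, MeromorphicNFAt (toMeromorphicNFOn f Set.univ) z := fun z =>
    meromorphicNFOn_toMeromorphicNFOn f Set.univ (Set.mem_univ z)
  have h2 : ∀ z, ∀ᶠ w in 𝓝[≠] z, toMeromorphicNFOn f Set.univ w = f w := fun z => by
    filter_upwards [hf'.toMeromorphicNFOn_eq_self_on_nhdsNE (Set.mem_univ z)] with w hw
      using hw
  exact ⟨_, h1, h2, fun z hz =>
    ((h1 z).eventuallyEq_nhdsNE_iff_eventuallyEq_nhds hz.meromorphicNFAt).1 (h2 z)⟩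

namespace IsNFSolution

variable {a : ℂ} {U : ℂ → ℂ} {z₀ z₁ c : ℂ} {τ μ : ℝ} {G : ℂ → ℂ}

/-- Since residues vanish, subtracting the kernels leaves only removable singularities. The normal
form of the remainder is entire, periodic and bounded, so Liouville applies. -/
theorem exists_eq_of_isDoublePoleKernel (hU : IsNFSolution a U) (hG : IsDoublePoleKernel τ μ G)
    (hc : c ^ 2 = -120) (h0 : HasLeadingTerm U z₀ (-2) c) (h1 : HasLeadingTerm U z₁ (-2) (-c))
    (hper : ∀ (n : ℤ) z, U (z + n * (τ * Complex.I)) = U z)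
    (hne : ∀ n : ℤ, z₁ - z₀ ≠ n * (τ * Complex.I))
    (hpole : ∀ z, ¬AnalyticAt ℂ U z → ∃ n : ℤ,
      z = z₀ + n * (τ * Complex.I) ∨ z = z₁ + n * (τ * Complex.I)) :
    ∃ p, ∀ z, (∀ n : ℤ, z - z₀ ≠ n * (τ * Complex.I)) → (∀ n : ℤ, z - z₁ ≠ n * (τ * Complex.I)) →
      U z = p + c * (G (z - z₀) - G (z - z₁)) := by
  set F₀ : ℂ → ℂ := fun z => U z - c * (G (z - z₀) - G (z - z₁)) with hF₀
  have hGan : ∀ w z : ℂ, (∀ n : ℤ, z - w ≠ n * (τ * Complex.I)) →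
      AnalyticAt ℂ (fun z => G (z - w)) z := fun w z hz =>
    (hG.analyticAt _ hz).comp_of_eq (f := fun z => z - w) (by fun_prop) rfl
  have hoff : ∀ z, (∀ n : ℤ, z - z₀ ≠ n * (τ * Complex.I)) →
      (∀ n : ℤ, z - z₁ ≠ n * (τ * Complex.I)) → AnalyticAt ℂ U z := by
    intro z hz0 hz1
    by_contra h
    obtain ⟨n, h | h⟩ := hpole z h
    · exact hz0 n (by rw [h]; ring)
    · exact hz1 n (by rw [h]; ring)
  have hFan : ∀ z, (∀ n : ℤ, z - z₀ ≠ n * (τ * Complex.I)) →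
      (∀ n : ℤ, z - z₁ ≠ n * (τ * Complex.I)) → AnalyticAt ℂ F₀ z := fun z hz0 hz1 =>
    (hoff z hz0 hz1).sub (analyticAt_const.mul ((hGan _ _ hz0).sub (hGan _ _ hz1)))
  have hFper : ∀ (n : ℤ) z, F₀ (z + n * (τ * Complex.I)) = F₀ z := by
    intro n z
    simp only [hF₀, hper, add_sub_right_comm, hG.periodic]
  obtain ⟨g, hg, hge⟩ := hG.polar
  have hpol : ∀ w : ℂ, ∀ᶠ z in 𝓝[≠] w, G (z - w) = ((z - w) ^ 2)⁻¹ + g (z - w) := by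
    intro w
    have := tendsto_add_const_nhdsNE w (-w)
    rw [add_neg_cancel] at this
    simpa [← sub_eq_add_neg] using this.eventually hge
  have hg' : ∀ w : ℂ, AnalyticAt ℂ (fun z => g (z - w)) w := fun w =>
    hg.comp_of_eq (f := fun z => z - w) (by fun_prop) (sub_self w)
  have hF0 : ∃ u, AnalyticAt ℂ u z₀ ∧ ∀ᶠ z in 𝓝[≠] z₀, F₀ z = u z := by
    obtain ⟨v, hv, hve⟩ := hU.exists_analyticAt_of_hasLeadingTerm h0 hc
    have h2 : AnalyticAt ℂ (fun z => G (z - z₁)) z₀ := by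
      refine hGan _ _ fun n hn => hne (-n) ?_
      push_cast
      linear_combination -hn
    refine ⟨fun z => v z - c * (g (z - z₀) - G (z - z₁)),
      hv.sub (analyticAt_const.mul ((hg' z₀).sub h2)), ?_⟩
    filter_upwards [hve, hpol z₀] with z e1 e2
    simp only [hF₀]
    rw [e1, e2]; ring
  have hF1 : ∃ u, AnalyticAt ℂ u z₁ ∧ ∀ᶠ z in 𝓝[≠] z₁, F₀ z = u z := by
    obtain ⟨v, hv, hve⟩ := hU.exists_analyticAt_of_hasLeadingTerm h1 (by rw [neg_sq, hc])
    refine ⟨fun z => v z - c * (G (z - z₀) - g (z - z₁)),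
      hv.sub (analyticAt_const.mul ((hGan _ _ hne).sub (hg' z₁))), ?_⟩
    filter_upwards [hve, hpol z₁] with z e1 e2
    simp only [hF₀]
    rw [e1, e2]; ring
  have hshift : ∀ (w : ℂ) (n : ℤ), (∃ u, AnalyticAt ℂ u w ∧ ∀ᶠ z in 𝓝[≠] w, F₀ z = u z) →
      ∃ u, AnalyticAt ℂ u (w + n * (τ * Complex.I)) ∧
        ∀ᶠ z in 𝓝[≠] (w + n * (τ * Complex.I)), F₀ z = u z := by
    rintro w n ⟨u, hu, hue⟩
    refine ⟨fun z => u (z + (-n : ℤ) * (τ * Complex.I)),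
      hu.comp_of_eq (f := fun z => z + (-n : ℤ) * (τ * Complex.I)) (by fun_prop)
        (by push_cast; ring), ?_⟩
    have := tendsto_add_const_nhdsNE (w + n * (τ * Complex.I)) ((-n : ℤ) * (τ * Complex.I))
    rw [show w + n * (τ * Complex.I) + (-n : ℤ) * (τ * Complex.I) = w by push_cast; ring] at this
    filter_upwards [this.eventually hue] with z hz
    rw [← hz, hFper]
  have hloc : ∀ z, ∃ u, AnalyticAt ℂ u z ∧ ∀ᶠ w in 𝓝[≠] z, F₀ w = u w := by
    intro z
    by_cases hz0 : ∀ n : ℤ, z - z₀ ≠ n * (τ * Complex.I)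
    · by_cases hz1 : ∀ n : ℤ, z - z₁ ≠ n * (τ * Complex.I)
      · exact ⟨F₀, hFan z hz0 hz1, Eventually.of_forall fun _ => rfl⟩
      · push Not at hz1
        obtain ⟨n, hn⟩ := hz1
        rw [sub_eq_iff_eq_add'.1 hn]
        exact hshift z₁ n hF1
    · push Not at hz0
      obtain ⟨n, hn⟩ := hz0
      rw [sub_eq_iff_eq_add'.1 hn]
      exact hshift z₀ n hF0
  have hmer : Meromorphic F₀ := fun z => by
    obtain ⟨u, hu, hue⟩ := hloc z
    refine hu.meromorphicAt.congr ?_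
    filter_upwards [hue] with w hw using hw.symm
  obtain ⟨F, hFnf, hFne, hFeq⟩ := hmer.exists_meromorphicNFAt
  have hFa : ∀ z, AnalyticAt ℂ F z := fun z => by
    obtain ⟨u, hu, hue⟩ := hloc z
    refine (hFnf z).analyticAt_of_eventuallyEq hu ?_
    filter_upwards [hue, hFne z] with w e1 e2 using e2.trans e1
  have hFp : ∀ (n : ℤ) z, F (z + n * (τ * Complex.I)) = F z := by
    intro n
    refine fun z => congrFun (eq_of_meromorphicNFAt_of_eventuallyEq (z₀ := 0)
      (U := fun z => F (z + n * (τ * Complex.I)))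
      (fun z => meromorphicNFAt_comp_add_const_iff_meromorphicNFAt.2 (hFnf _)) hFnf ?_) z
    filter_upwards [hFne 0, (tendsto_add_const_nhdsNE 0 _).eventually
      (hFne (0 + n * (τ * Complex.I)))] with w e1 e2
    rw [e1, e2, hFper]
  have hdiff : Differentiable ℂ F := fun z => (hFa z).differentiableAt
  obtain ⟨C, hC⟩ := exists_bound a
  obtain ⟨R, hR⟩ := hG.near_or_far
  obtain ⟨B, hB⟩ := (isCompact_closedBall (0 : ℂ) (R + ‖z₀‖ + ‖z₁‖)).exists_bound_of_continuousOn
    hdiff.continuous.continuousOn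
  -- Within `R` of either lattice coset, shift into a compact disc and use `B`. Otherwise `U` is
  -- analytic on the unit disc about `z`, and `C` bounds it while the kernels are at most 1.
  have hbdd : ∀ z, ‖F z‖ ≤ max B (C + ‖c‖ * (1 + 1)) := by
    intro z
    have near : ∀ (n : ℤ) (w : ℂ), ‖w‖ ≤ ‖z₀‖ + ‖z₁‖ → ‖z - w + n * (τ * Complex.I)‖ ≤ R →
        ‖F z‖ ≤ max B (C + ‖c‖ * (1 + 1)) := by
      intro n w hw h
      rw [← hFp n]
      refine (hB _ ?_).trans (le_max_left _ _)
      rw [mem_closedBall_zero_iff]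
      have := norm_add_le (z - w + n * (τ * Complex.I)) w
      rw [show z - w + n * (τ * Complex.I) + w = z + n * (τ * Complex.I) by ring] at this
      linarith
    obtain ⟨n, h | ⟨hG0, hf0⟩⟩ := hR (z - z₀)
    · exact near n z₀ (by linarith [norm_nonneg z₁]) h
    obtain ⟨n', h | ⟨hG1, hf1⟩⟩ := hR (z - z₁)
    · exact near n' z₁ (by linarith [norm_nonneg z₀]) h
    have hno : ∀ x : ℂ, (∀ m : ℤ, 1 ≤ ‖z - x - m * (τ * Complex.I)‖) → ∀ w ∈ Metric.ball z 1,
        ∀ m : ℤ, w - x ≠ m * (τ * Complex.I) := by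
      intro x hx w hw m h
      have h2 := hx m
      rw [← h, show z - x - (w - x) = z - w by ring, ← dist_eq_norm, dist_comm] at h2
      exact absurd hw (not_lt.2 h2)
    have hUz := hC U hU z fun w hw => hoff w (hno z₀ hf0 w hw) (hno z₁ hf1 w hw)
    have hz := Metric.mem_ball_self (x := z) one_pos
    rw [(hFeq z (hFan z (hno z₀ hf0 z hz) (hno z₁ hf1 z hz))).eq_of_nhds]
    refine le_trans ?_ (le_max_right _ _)
    refine (norm_sub_le _ _).trans (add_le_add hUz ?_)
    rw [norm_mul]
    exact mul_le_mul_of_nonneg_left ((norm_sub_le _ _).trans (add_le_add hG0 hG1)) (norm_nonneg c)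
  have hb : Bornology.IsBounded (Set.range F) := by
    rw [isBounded_iff_forall_norm_le]
    exact ⟨_, by rintro _ ⟨z, rfl⟩; exact hbdd z⟩
  refine ⟨F 0, fun z hz0 hz1 => ?_⟩
  rw [hdiff.apply_eq_apply_of_bounded hb 0 z, (hFeq z (hFan z hz0 hz1)).eq_of_nhds]
  simp only [hF₀]
  ring

end IsNFSolution

/-! ### Relations forced by the equation. -/

/-- Double-angle formulas. The convention `x / 0 = 0` makes both sides vanish at the zeros of `cosh
(k z)` and at the poles, so no exception is needed. -/
theorem tanhProfile_eq (k : ℝ) (z : ℂ) : tanhProfile k z =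
    ((2 * √30 / √11 : ℝ) : ℂ) *
      (Complex.sinh (2 * (k * z)) * ((Complex.cosh (2 * (k * z)))⁻¹) ^ 2) := by
  have h1 := Complex.sinh_two_mul (k * z)
  have h2 := Complex.cosh_two_mul (k * z)
  have h3 := Complex.cosh_sq (k * z)
  rw [h1, h2]
  simp only [tanhProfile, Complex.tanh_eq_sinh_div_cosh]
  set s := Complex.sinh (k * z)
  set c := Complex.cosh (k * z)
  push_cast
  by_cases hc : c = 0
  · simp [hc]
  have h4 : 1 + (s / c) ^ 2 = (c ^ 2 + s ^ 2) / c ^ 2 := by field_simp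
  have h5 : 1 - (s / c) ^ 2 = 1 / c ^ 2 := by
    field_simp; linear_combination h3
  rw [h4, h5]
  by_cases hd : c ^ 2 + s ^ 2 = 0
  · simp [hd]
  have h11 : (√11 : ℂ) ≠ 0 := by
    have : √11 ≠ 0 := by positivity
    exact_mod_cast this
  field_simp
  ring

namespace IsNFSolution

variable {a : ℂ} {U : ℂ → ℂ} {z₀ z₁ c p : ℂ} {τ μ : ℝ} {G : ℂ → ℂ}

theorem ne_lattice_of_re_ne {z w : ℂ} (h : z.re ≠ w.re) (n : ℤ) : z - w ≠ n * (τ * Complex.I) := by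
  intro hn
  have := congrArg Complex.re hn
  simp at this
  exact h (by linarith)

/-- The equation, written in terms of the two translated kernels. -/
theorem kernel_identity (hU : IsNFSolution a U) (hG : IsDoublePoleKernel τ μ G)
    (hc : c ^ 2 = -120) (h01 : z₀.re = z₁.re)
    (hp : ∀ z, (∀ n : ℤ, z - z₀ ≠ n * (τ * Complex.I)) → (∀ n : ℤ, z - z₁ ≠ n * (τ * Complex.I)) →
      U z = p + c * (G (z - z₀) - G (z - z₁))) {z : ℂ} (hz : z.re ≠ z₀.re) :
    p ^ 3 - p + c * (G (z - z₀) - G (z - z₁)) * (360 * G (z - z₀) * G (z - z₁)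
      + (120 * μ ^ 2 + 6 * a) * (G (z - z₀) + G (z - z₁)) + 16 * μ ^ 4 + 4 * a * μ ^ 2 - 1
      + 3 * p ^ 2 + 3 * p * c * (G (z - z₀) - G (z - z₁))) = 0 := by
  have hz1 : z.re ≠ z₁.re := h01 ▸ hz
  have hev : U =ᶠ[𝓝 z] fun z => p + c * (G (z - z₀) - G (z - z₁)) := by
    have hopen : IsOpen {z : ℂ | z.re ≠ z₀.re} :=
      isOpen_ne_fun Complex.continuous_re continuous_const
    filter_upwards [hopen.mem_nhds hz] with w hw
    exact hp w (ne_lattice_of_re_ne hw) (ne_lattice_of_re_ne (h01 ▸ hw))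
  have han : ∀ w : ℂ, z.re ≠ w.re → AnalyticAt ℂ (fun z => G (z - w)) z := fun w hw =>
    (hG.analyticAt _ (ne_lattice_of_re_ne hw)).comp_of_eq (f := fun z => z - w) (by fun_prop) rfl
  have hd : ∀ k : ℕ, 0 < k → iteratedDeriv k U z =
      c * (iteratedDeriv k G (z - z₀) - iteratedDeriv k G (z - z₁)) := by
    intro k hk
    rw [hev.iteratedDeriv_eq, iteratedDeriv_const_add hk, iteratedDeriv_const_mul_field,
      iteratedDeriv_fun_sub (han z₀ hz).contDiffAt (han z₁ hz1).contDiffAt,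
      iteratedDeriv_comp_sub_const, iteratedDeriv_comp_sub_const]
  have hUan : AnalyticAt ℂ U z :=
    (analyticAt_const.add (analyticAt_const.mul ((han z₀ hz).sub (han z₁ hz1)))).congr hev.symm
  have hode := hU.ode z hUan
  rw [hd 4 (by norm_num), hd 2 (by norm_num), hev.eq_of_nhds,
    hG.iteratedDeriv_two _ (ne_lattice_of_re_ne hz), hG.iteratedDeriv_two _ (ne_lattice_of_re_ne hz1),
    hG.iteratedDeriv_four _ (ne_lattice_of_re_ne hz),
    hG.iteratedDeriv_four _ (ne_lattice_of_re_ne hz1)] at hode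
  -- By `c² = -120` the cubic terms combine: `120(X³ - Y³) - 120(X - Y)³ = 360 XY(X - Y)`.
  linear_combination hode - c * (G (z - z₀) - G (z - z₁)) ^ 3 * hc

end IsNFSolution

namespace IsNFSolution

variable {a : ℂ} {U : ℂ → ℂ} {z₀ c p : ℂ} {τ μ : ℝ} {G : ℂ → ℂ}

/-- On the line through the poles, `X` and `Y` tend to 0 at infinity, which gives `p³ = p`. Since `X
≠ Y`, the factor `c(X - Y)` can be divided out. Replacing `t` by `-t` exchanges `X` and `Y`, and the
antisymmetric part yields `p = 0`; a second limit gives the relation between `a` and `μ`. -/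
theorem kernel_relations (hU : IsNFSolution a U) (hG : IsDoublePoleKernel τ μ G)
    (hc : c ^ 2 = -120) (hne : ∀ n : ℤ, starRingEnd ℂ z₀ - z₀ ≠ n * (τ * Complex.I))
    (hp : ∀ z, (∀ n : ℤ, z - z₀ ≠ n * (τ * Complex.I)) →
      (∀ n : ℤ, z - starRingEnd ℂ z₀ ≠ n * (τ * Complex.I)) →
      U z = p + c * (G (z - z₀) - G (z - starRingEnd ℂ z₀))) :
    p = 0 ∧ 16 * (μ : ℂ) ^ 4 + 4 * a * μ ^ 2 = 1 ∧ ∀ t : ℝ, t ≠ 0 →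
      360 * G (t - z₀.im * Complex.I) * G (t + z₀.im * Complex.I) + (120 * μ ^ 2 + 6 * a) *
        (G (t - z₀.im * Complex.I) + G (t + z₀.im * Complex.I)) = 0 := by
  have hc0 : c ≠ 0 := by rintro rfl; norm_num at hc
  set β := z₀.im with hβ
  have hz0 : ∀ t : ℝ, (z₀.re + t : ℂ) - z₀ = t - β * Complex.I := by
    intro t; apply Complex.ext <;> simp [hβ]
  have hz1 : ∀ t : ℝ, (z₀.re + t : ℂ) - starRingEnd ℂ z₀ = t + β * Complex.I := by
    intro t; apply Complex.ext <;> simp [hβ]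
  set X : ℝ → ℂ := fun t => G (t - β * Complex.I) with hX
  set Y : ℝ → ℂ := fun t => G (t + β * Complex.I) with hY
  have hid : ∀ t : ℝ, t ≠ 0 → p ^ 3 - p + c * (X t - Y t) * (360 * X t * Y t
      + (120 * μ ^ 2 + 6 * a) * (X t + Y t) + 16 * μ ^ 4 + 4 * a * μ ^ 2 - 1
      + 3 * p ^ 2 + 3 * p * c * (X t - Y t)) = 0 := by
    intro t ht
    have := hU.kernel_identity hG hc (z₁ := starRingEnd ℂ z₀) (by simp) hp (z := z₀.re + t)
      (by simpa using ht)
    rwa [hz0, hz1] at this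
  have hlim0 : Tendsto (fun t : ℝ => (t ^ 2)⁻¹) atTop (𝓝 0) :=
    tendsto_inv_atTop_zero.comp (tendsto_pow_atTop two_ne_zero)
  have hXlim : Tendsto X atTop (𝓝 0) := by
    refine squeeze_zero_norm' ?_ hlim0
    filter_upwards [eventually_gt_atTop 0] with t ht
    simpa using hG.norm_le (t - β * Complex.I) (by simpa using ht.ne')
  have hYlim : Tendsto Y atTop (𝓝 0) := by
    refine squeeze_zero_norm' ?_ hlim0
    filter_upwards [eventually_gt_atTop 0] with t ht
    simpa using hG.norm_le (t + β * Complex.I) (by simpa using ht.ne')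
  have hswap : ∀ t, X (-t) = Y t := by
    intro t
    simp only [hX, hY]
    rw [← hG.even]
    push_cast
    ring_nf
  have hXY : ∀ t : ℝ, t ≠ 0 → X t - Y t ≠ 0 := by
    intro t ht h
    obtain ⟨n, h | h⟩ := hG.inj (t - β * Complex.I) (t + β * Complex.I)
      (fun n => by
        rw [← hz0]; exact ne_lattice_of_re_ne (by simpa using ht) n)
      (fun n => by
        rw [← hz1]; exact ne_lattice_of_re_ne (by simpa using ht) n) (sub_eq_zero.1 h)
    · refine hne n ?_
      rw [← h, ← hz0, ← hz1]; ring
    · have := congrArg Complex.re h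
      simp at this
      exact ht (by linarith)
  have hp3 : p ^ 3 - p = 0 := by
    have h1 := ((hXlim.sub hYlim).const_mul c).mul
      (((((((hXlim.const_mul 360).mul hYlim).add
        ((hXlim.add hYlim).const_mul (120 * (μ : ℂ) ^ 2 + 6 * a))).add_const
        (16 * (μ : ℂ) ^ 4)).add_const (4 * a * μ ^ 2)).sub_const 1).add_const (3 * p ^ 2) |>.add
        ((hXlim.sub hYlim).const_mul (3 * p * c)))
    have h2 := h1.const_add (p ^ 3 - p)
    have h3 := tendsto_nhds_unique (h2.congr' (f₂ := fun _ => 0) ?_) tendsto_const_nhds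
    · simpa using h3
    · filter_upwards [eventually_gt_atTop 0] with t ht using hid t ht.ne'
  have hH : ∀ t : ℝ, t ≠ 0 → 360 * X t * Y t
      + (120 * μ ^ 2 + 6 * a) * (X t + Y t) + 16 * μ ^ 4 + 4 * a * μ ^ 2 - 1
      + 3 * p ^ 2 + 3 * p * c * (X t - Y t) = 0 := by
    intro t ht
    have h1 := hid t ht
    rw [hp3, zero_add] at h1
    exact (mul_eq_zero.1 h1).resolve_left (mul_ne_zero hc0 (hXY t ht))
  have hp0 : p = 0 := by
    have h1 := hH 1 one_ne_zero
    have h2 := hH (-1) (by norm_num)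
    have h3 : Y (-1) = X 1 := by rw [← hswap, neg_neg]
    rw [hswap, h3] at h2
    have h4 : p * (c * (X 1 - Y 1)) = 0 := by linear_combination (h1 - h2) / 6
    exact (mul_eq_zero.1 h4).resolve_right (mul_ne_zero hc0 (hXY 1 one_ne_zero))
  subst hp0
  have hμ : 16 * (μ : ℂ) ^ 4 + 4 * a * μ ^ 2 = 1 := by
    have h1 := ((((hXlim.const_mul 360).mul hYlim).add
        ((hXlim.add hYlim).const_mul (120 * (μ : ℂ) ^ 2 + 6 * a))).add_const
        (16 * (μ : ℂ) ^ 4)).add_const (4 * a * μ ^ 2)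
    have h3 := tendsto_nhds_unique (h1.congr' (f₂ := fun _ => 1) ?_) tendsto_const_nhds
    · simpa using h3
    · filter_upwards [eventually_gt_atTop 0] with t ht
      linear_combination hH t ht.ne'
  refine ⟨rfl, hμ, fun t ht => ?_⟩
  linear_combination hH t ht - hμ

/-- The trigonometric identities which determine the period and the position of the poles. -/
theorem sq_cos_eq_sq_sin_of_relations {a μ θ : ℝ} (hμ : μ ≠ 0)
    (h : ∀ t : ℝ, t ≠ 0 → 60 * μ ^ 2 + (20 * μ ^ 2 + a) *
      (2 * Real.sinh (μ * t) ^ 2 * (Real.cos θ ^ 2 - Real.sin θ ^ 2) - 2 * Real.sin θ ^ 2) = 0) :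
    Real.sin θ ^ 2 = 1 / 2 ∧ Real.cos θ ^ 2 = 1 / 2 ∧ a = 40 * μ ^ 2 := by
  have hcs := Real.sin_sq_add_cos_sq θ
  -- The relation is affine in `sinh² (μ t)`, so two values of `t` with distinct squares separate
  -- its coefficients.
  have hs : Real.sinh (μ * 1) ^ 2 ≠ Real.sinh (μ * 2) ^ 2 := by
    intro hs
    rcases sq_eq_sq_iff_eq_or_eq_neg.1 hs with hs | hs
    · have := Real.sinh_injective hs
      exact hμ (by linarith)
    · rw [← Real.sinh_neg] at hs
      have := Real.sinh_injective hs
      exact hμ (by linarith)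
  have h1 := h 1 one_ne_zero
  have h2 := h 2 two_ne_zero
  have h3 : (Real.sinh (μ * 1) ^ 2 - Real.sinh (μ * 2) ^ 2) *
      ((20 * μ ^ 2 + a) * (Real.cos θ ^ 2 - Real.sin θ ^ 2)) = 0 := by
    linear_combination (h1 - h2) / 2
  have hμ2 : 0 < μ ^ 2 := by positivity
  rcases mul_eq_zero.1 ((mul_eq_zero.1 h3).resolve_left (sub_ne_zero.2 hs)) with h4 | h4
  -- If `20μ² + a = 0`, only `60μ² = 0` remains.
  · rw [h4] at h1
    linarith
  · have hs2 : Real.sin θ ^ 2 = 1 / 2 := by linarith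
    refine ⟨hs2, by linarith, ?_⟩
    rw [h4, hs2] at h1
    linarith

end IsNFSolution

/-! ### Identification with the profile. -/

theorem Complex.sinh_mul_add_mul_I (μ β : ℝ) (w : ℂ) :
    Complex.sinh (μ * (w + β * Complex.I)) = Complex.sinh (μ * w) * Real.cos (μ * β) +
      Complex.cosh (μ * w) * Real.sin (μ * β) * Complex.I := by
  rw [show (μ : ℂ) * (w + β * Complex.I) = μ * w + (μ * β : ℝ) * Complex.I by push_cast; ring,
    Complex.sinh_add, Complex.sinh_mul_I, Complex.cosh_mul_I, Complex.ofReal_cos,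
    Complex.ofReal_sin]
  ring

theorem Complex.sinh_mul_sub_mul_I (μ β : ℝ) (w : ℂ) :
    Complex.sinh (μ * (w - β * Complex.I)) = Complex.sinh (μ * w) * Real.cos (μ * β) -
      Complex.cosh (μ * w) * Real.sin (μ * β) * Complex.I := by
  have := Complex.sinh_mul_add_mul_I μ (-β) w
  simp only [mul_neg, Real.cos_neg, Real.sin_neg, Complex.ofReal_neg] at this
  rw [sub_eq_add_neg, ← neg_mul, this]
  ring

theorem tanhProfile_neg_right (k : ℝ) (z : ℂ) : tanhProfile k (-z) = -tanhProfile k z := by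
  rw [tanhProfile_eq, tanhProfile_eq, mul_neg, mul_neg, Complex.sinh_neg, Complex.cosh_neg]
  ring

theorem tanhProfile_neg_left (k : ℝ) (z : ℂ) : tanhProfile (-k) z = -tanhProfile k z := by
  rw [← tanhProfile_neg_right, tanhProfile_eq, tanhProfile_eq, Complex.ofReal_neg, neg_mul_comm]

theorem exists_eq_of_sq_eq_neg {c : ℂ} (hc : c ^ 2 = -120) :
    ∃ ε : ℝ, (ε = 1 ∨ ε = -1) ∧ c * Complex.I = ε * (2 * √30 : ℝ) := by
  have h30 : ((√30 : ℝ) : ℂ) ^ 2 = 30 := by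
    rw [← Complex.ofReal_pow, Real.sq_sqrt (by norm_num)]; norm_num
  have h1 : (c * Complex.I) ^ 2 = ((2 * √30 : ℝ) : ℂ) ^ 2 := by
    rw [mul_pow, Complex.I_sq, hc]
    push_cast
    linear_combination -4 * h30
  rcases sq_eq_sq_iff_eq_or_eq_neg.1 h1 with h | h
  · exact ⟨1, Or.inl rfl, by rw [h]; simp⟩
  · exact ⟨-1, Or.inr rfl, by rw [h]; simp⟩

theorem exists_eq_of_sin_cos {θ : ℝ} (hs : Real.sin θ ^ 2 = 1 / 2) (hc : Real.cos θ ^ 2 = 1 / 2) :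
    ∃ ε : ℝ, (ε = 1 ∨ ε = -1) ∧ Real.cos θ * Real.sin θ = ε / 2 := by
  have h1 : (2 * (Real.cos θ * Real.sin θ)) ^ 2 = 1 ^ 2 := by
    rw [mul_pow, mul_pow, hs, hc]; norm_num
  rcases sq_eq_sq_iff_eq_or_eq_neg.1 h1 with h | h
  · exact ⟨1, Or.inl rfl, by linarith⟩
  · exact ⟨-1, Or.inr rfl, by linarith⟩

/-- The combination of two kernels whose poles lie a quarter period off the real axis. -/
theorem inv_sinh_sq_sub_inv_sinh_sq {μ β ε : ℝ} (hs : Real.sin (μ * β) ^ 2 = 1 / 2)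
    (hc : Real.cos (μ * β) ^ 2 = 1 / 2) (hε : Real.cos (μ * β) * Real.sin (μ * β) = ε / 2) {w : ℂ}
    (h1 : Complex.sinh (μ * (w - β * Complex.I)) ≠ 0)
    (h2 : Complex.sinh (μ * (w + β * Complex.I)) ≠ 0) :
    (Complex.sinh (μ * (w - β * Complex.I)) ^ 2)⁻¹ -
        (Complex.sinh (μ * (w + β * Complex.I)) ^ 2)⁻¹ =
      4 * Complex.I * ε *
        (Complex.sinh (2 * (μ * w)) * ((Complex.cosh (2 * (μ * w)))⁻¹) ^ 2) := by
  have hprod : Complex.sinh (μ * (w - β * Complex.I)) * Complex.sinh (μ * (w + β * Complex.I)) =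
      Complex.cosh (2 * (μ * w)) / 2 := by
    have hs' : (Real.sin (μ * β) : ℂ) ^ 2 = 1 / 2 := by
      rw [← Complex.ofReal_pow, hs]; norm_num
    have hc' : (Real.cos (μ * β) : ℂ) ^ 2 = 1 / 2 := by
      rw [← Complex.ofReal_pow, hc]; norm_num
    rw [Complex.sinh_mul_add_mul_I, Complex.sinh_mul_sub_mul_I, Complex.cosh_two_mul]
    linear_combination Complex.sinh (μ * w) ^ 2 * hc' + Complex.cosh (μ * w) ^ 2 * hs'
      - Complex.cosh (μ * w) ^ 2 * (Real.sin (μ * β) : ℂ) ^ 2 * Complex.I_sq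
  have hdiff : Complex.sinh (μ * (w + β * Complex.I)) ^ 2 -
      Complex.sinh (μ * (w - β * Complex.I)) ^ 2 = Complex.I * ε * Complex.sinh (2 * (μ * w)) := by
    have hε' : (Real.cos (μ * β) : ℂ) * Real.sin (μ * β) = ε / 2 := by exact_mod_cast hε
    rw [Complex.sinh_mul_add_mul_I, Complex.sinh_mul_sub_mul_I, Complex.sinh_two_mul]
    linear_combination 4 * Complex.I * Complex.sinh (μ * w) * Complex.cosh (μ * w) * hε'
  have hcosh : Complex.cosh (2 * (μ * w)) ≠ 0 := by
    intro h
    rw [h, zero_div] at hprod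
    exact mul_ne_zero h1 h2 hprod
  rw [inv_sub_inv (pow_ne_zero 2 h1) (pow_ne_zero 2 h2), ← mul_pow, hprod, hdiff]
  field_simp
  ring

theorem HasLeadingTerm.not_analyticAt {f : ℂ → ℂ} {z₀ c : ℂ} {n : ℤ}
    (hf : HasLeadingTerm f z₀ n c) (hc : c ≠ 0) (hn : n < 0) : ¬AnalyticAt ℂ f z₀ := fun h =>
  hc (hf.unique ((HasLeadingTerm.of_analyticAt h).weaken hn))

namespace IsNFSolution

variable {U : ℂ → ℂ}

theorem analyticAt_of_periodic {z T : ℂ} (hT : ∀ w, U (w + T) = U w)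
    (h : AnalyticAt ℂ U (z + T)) : AnalyticAt ℂ U z := by
  have h3 : AnalyticAt ℂ (U ∘ fun w => w + T) z := h.comp_of_eq (by fun_prop) rfl
  have h4 : (U ∘ fun w => w + T) = U := funext hT
  rwa [h4] at h3

theorem eq_tanhProfile {a k : ℝ} (hk : k ^ 2 = 1 / (4 * √11)) (hU : IsNFSolution a U)
    (hr : IsRealOnReals U) (hh : IsHomoclinic (realTrace U)) :
    a = 10 / √11 ∧ ∃ ε : ℝ, (ε = 1 ∨ ε = -1) ∧ ∃ Z₀ : ℝ,
      ∀ z : ℂ, AnalyticAt ℂ U z → U z = (ε : ℂ) * tanhProfile k (z - (Z₀ : ℂ)) := by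
  obtain ⟨z₀, c, τ, hc, h0, h1, hper, hne, hpole⟩ := hU.exists_poles hr hh
  have hc0 : c ≠ 0 := by rintro rfl; norm_num at hc
  -- The rational kernel has `μ = 0`, for which `16μ⁴ + 4aμ² = 1` is absurd.
  by_cases hτ : τ = 0
  · subst hτ
    obtain ⟨p, hp⟩ := hU.exists_eq_of_isDoublePoleKernel isDoublePoleKernel_inv_sq hc h0 h1 hper
      hne hpole
    obtain ⟨-, h, -⟩ := hU.kernel_relations isDoublePoleKernel_inv_sq hc hne hp
    norm_num at h
  obtain ⟨μ, hμτ⟩ : ∃ μ, μ * τ = Real.pi := ⟨Real.pi / τ, by field_simp⟩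
  have hμ0 : μ ≠ 0 := by
    rintro rfl
    exact Real.pi_ne_zero (by rw [← hμτ, zero_mul])
  have hμ0' : (μ : ℂ) ≠ 0 := by exact_mod_cast hμ0
  have hG := isDoublePoleKernel_inv_sinh_sq hμτ
  obtain ⟨p, hp⟩ := hU.exists_eq_of_isDoublePoleKernel hG hc h0 h1 hper hne hpole
  obtain ⟨rfl, hμa, hrel⟩ := hU.kernel_relations hG hc hne hp
  set β := z₀.im with hβ
  have hsinh : ∀ z : ℂ, (∀ n : ℤ, z ≠ n * (τ * Complex.I)) → Complex.sinh (μ * z) ≠ 0 := by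
    intro z hz h
    obtain ⟨n, hn⟩ := (Complex.sinh_eq_zero_iff_exists_int _).1 h
    refine hz n (mul_left_cancel₀ hμ0' ?_)
    have : (μ : ℂ) * τ = Real.pi := by exact_mod_cast hμτ
    rw [hn, ← this]; ring
  have hre : ∀ z : ℂ, z.re ≠ 0 → Complex.sinh (μ * z) ≠ 0 := by
    intro z hz
    refine hsinh z fun n hn => hz ?_
    rw [hn]; simp
  have hrel' : ∀ t : ℝ, t ≠ 0 → 60 * μ ^ 2 + (20 * μ ^ 2 + a) *
      (2 * Real.sinh (μ * t) ^ 2 * (Real.cos (μ * β) ^ 2 - Real.sin (μ * β) ^ 2) -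
        2 * Real.sin (μ * β) ^ 2) = 0 := by
    intro t ht
    have h3 := hrel t ht
    have hm := hre (t - β * Complex.I) (by simpa using ht)
    have hpl := hre (t + β * Complex.I) (by simpa using ht)
    have h4 : 60 * (μ : ℂ) ^ 2 + (20 * μ ^ 2 + a) * (Complex.sinh (μ * (t - β * Complex.I)) ^ 2 +
        Complex.sinh (μ * (t + β * Complex.I)) ^ 2) = 0 := by
      field_simp at h3
      have h5 : (6 * (μ : ℂ) ^ 2) ≠ 0 := mul_ne_zero (by norm_num) (pow_ne_zero 2 hμ0')
      refine (mul_eq_zero.1 (?_ : (6 * (μ : ℂ) ^ 2) * _ = 0)).resolve_left h5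
      linear_combination h3
    rw [Complex.sinh_mul_add_mul_I, Complex.sinh_mul_sub_mul_I] at h4
    have h6 : Complex.cosh (μ * t) ^ 2 = Complex.sinh (μ * t) ^ 2 + 1 := Complex.cosh_sq _
    have h7 : 60 * (μ : ℂ) ^ 2 + (20 * μ ^ 2 + a) *
      (2 * Complex.sinh (μ * t) ^ 2 * ((Real.cos (μ * β) : ℂ) ^ 2 - (Real.sin (μ * β) : ℂ) ^ 2) -
        2 * (Real.sin (μ * β) : ℂ) ^ 2) = 0 := by
      linear_combination h4 + (20 * (μ : ℂ) ^ 2 + a) * 2 * (Real.sin (μ * β) : ℂ) ^ 2 * h6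
        - (20 * (μ : ℂ) ^ 2 + a) * 2 * (Real.sin (μ * β) : ℂ) ^ 2 * Complex.cosh (μ * t) ^ 2
          * Complex.I_sq
    rw [← Complex.ofReal_mul, ← Complex.ofReal_sinh] at h7
    exact_mod_cast h7
  obtain ⟨hsin, hcos, ha⟩ := sq_cos_eq_sq_sin_of_relations hμ0 hrel'
  have h11 : √11 ^ 2 = 11 := Real.sq_sqrt (by norm_num)
  have h11p : 0 < √11 := by positivity
  have hμa' : 16 * μ ^ 4 + 4 * a * μ ^ 2 = 1 := by exact_mod_cast hμa
  -- With `a = 40μ²` the relation reads `176μ⁴ = 1`, and `176 = (4√11)²`.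
  have hμk : μ ^ 2 = k ^ 2 := by
    have h3 : (μ ^ 2) ^ 2 = (k ^ 2) ^ 2 := by
      rw [hk, div_pow, mul_pow, h11]
      rw [ha] at hμa'
      linarith
    exact (pow_left_inj₀ (by positivity) (by positivity) two_ne_zero).1 h3
  refine ⟨?_, ?_⟩
  · rw [ha, hμk, hk]; field_simp; norm_num
  obtain ⟨ε₁, hε₁, hcI⟩ := exists_eq_of_sq_eq_neg hc
  obtain ⟨ε₂, hε₂, hsc⟩ := exists_eq_of_sin_cos hsin hcos
  have hform : ∀ z, AnalyticAt ℂ U z →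
      U z = ((ε₁ * ε₂ : ℝ) : ℂ) * tanhProfile μ (z - (z₀.re : ℂ)) := by
    intro z hz
    have hz0 : ∀ n : ℤ, z - z₀ ≠ n * (τ * Complex.I) := by
      intro n hn
      rw [sub_eq_iff_eq_add'.1 hn] at hz
      exact h0.not_analyticAt hc0 (by norm_num) (analyticAt_of_periodic (hper n) hz)
    have hz1 : ∀ n : ℤ, z - starRingEnd ℂ z₀ ≠ n * (τ * Complex.I) := by
      intro n hn
      rw [sub_eq_iff_eq_add'.1 hn] at hz
      exact h1.not_analyticAt (neg_ne_zero.2 hc0) (by norm_num)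
        (analyticAt_of_periodic (hper n) hz)
    have e0 : z - z₀ = (z - z₀.re) - β * Complex.I := by
      conv_lhs => rw [← Complex.re_add_im z₀]
      rw [sub_sub]
    have e1 : z - starRingEnd ℂ z₀ = (z - z₀.re) + β * Complex.I := by
      apply Complex.ext <;> simp [hβ]
    have hs0 := hsinh _ hz0
    have hs1 := hsinh _ hz1
    rw [hp z hz0 hz1]
    rw [e0] at hs0 ⊢
    rw [e1] at hs1 ⊢
    have h3 := inv_sinh_sq_sub_inv_sinh_sq hsin hcos hsc hs0 hs1
    have h4 : (μ : ℂ) ^ 2 = 1 / (4 * (√11 : ℝ)) := by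
      have : μ ^ 2 = 1 / (4 * √11) := by rw [hμk, hk]
      rw [← Complex.ofReal_pow, this]; push_cast; ring
    have h5 : ((√11 : ℝ) : ℂ) ≠ 0 := by exact_mod_cast h11p.ne'
    rw [zero_add, ← mul_sub, h3, tanhProfile_eq, h4]
    push_cast at hcI ⊢
    field_simp
    linear_combination (ε₂ : ℂ) * Complex.sinh (2 * μ * (z - z₀.re)) *
      (Complex.cosh (2 * μ * (z - z₀.re)))⁻¹ ^ 2 * hcI
  have hεε : ∀ ε ε' : ℝ, (ε = 1 ∨ ε = -1) → (ε' = 1 ∨ ε' = -1) → (ε * ε' = 1 ∨ ε * ε' = -1) := by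
    rintro _ _ (rfl | rfl) (rfl | rfl) <;> norm_num
  rcases sq_eq_sq_iff_eq_or_eq_neg.1 hμk with h | h
  · exact ⟨ε₁ * ε₂, hεε _ _ hε₁ hε₂, z₀.re, fun z hz => by rw [hform z hz, h]⟩
  · refine ⟨ε₁ * ε₂ * (-1), hεε _ _ (hεε _ _ hε₁ hε₂) (Or.inr rfl), z₀.re, fun z hz => ?_⟩
    rw [hform z hz, h, tanhProfile_neg_left]
    push_cast; ring

end IsNFSolution

/-- The normal form of a meromorphic solution is a solution. -/
theorem IsMeromorphicSolution.exists_isNFSolution {a : ℝ} {U : ℂ → ℂ}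
    (hU : IsMeromorphicSolution a U) :
    ∃ V, IsNFSolution a V ∧ ∀ z, AnalyticAt ℂ U z → V =ᶠ[𝓝 z] U := by
  obtain ⟨V, hnf, hne, heq⟩ := hU.1.exists_meromorphicNFAt
  refine ⟨V, ⟨hnf, fun z hz => ?_⟩, heq⟩
  -- `V` may be analytic where `U` is not, so the equation is extended to such points by continuity
  -- from the nearby points where `U` is analytic.
  have hcont : ContinuousAt (fun w => iteratedDeriv 4 V w + a * iteratedDeriv 2 V w + V w ^ 3 - V w)
      z := by
    have h4 := (hz.iteratedDeriv 4).continuousAt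
    have h2 := (hz.iteratedDeriv 2).continuousAt
    have h0 := hz.continuousAt
    fun_prop
  refine tendsto_nhds_unique ((hcont.tendsto.mono_left nhdsWithin_le_nhds).congr' (f₂ := fun _ => 0)
    (l₁ := 𝓝[≠] z) ?_) tendsto_const_nhds
  filter_upwards [(hU.1 z).eventually_analyticAt] with w hw
  rw [(heq w hw).iteratedDeriv_eq, (heq w hw).iteratedDeriv_eq, (heq w hw).eq_of_nhds]
  exact hU.2 w hw

theorem IsMeromorphicSolution.eq_tanhProfile {a k : ℝ} {U : ℂ → ℂ} (hk : k ^ 2 = 1 / (4 * √11))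
    (hU : IsMeromorphicSolution a U) (hr : IsRealOnReals U) (hh : IsHomoclinic (realTrace U)) :
    a = 10 / √11 ∧ ∃ ε : ℝ, (ε = 1 ∨ ε = -1) ∧ ∃ Z₀ : ℝ,
      ∀ z : ℂ, AnalyticAt ℂ U z → U z = (ε : ℂ) * tanhProfile k (z - (Z₀ : ℂ)) := by
  obtain ⟨V, hV, heq⟩ := hU.exists_isNFSolution
  have hVr : IsRealOnReals V := fun x =>
    ⟨(hr x).1.congr (heq x (hr x).1).symm, by rw [(heq x (hr x).1).eq_of_nhds]; exact (hr x).2⟩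
  have htr : realTrace V = realTrace U := by
    funext x
    simp only [realTrace]
    rw [(heq x (hr x).1).eq_of_nhds]
  obtain ⟨ha, ε, hε, Z₀, h⟩ := hV.eq_tanhProfile hk hVr (htr ▸ hh)
  exact ⟨ha, ε, hε, Z₀, fun z hz => by
    rw [← (heq z hz).eq_of_nhds]; exact h z (hz.congr (heq z hz).symm)⟩

/-! ### Converse: the profile solves the equation. -/

/-- The derivatives of `c * sinh / cosh ^ 2` in terms of `1 / cosh`. -/
theorem iteratedDeriv_sinh_div_cosh_sq {𝕜 : Type*} [NontriviallyNormedField 𝕜] {s : Set 𝕜}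
    (hs : IsOpen s) {S C : 𝕜 → 𝕜} {c r : 𝕜} (hS : ∀ z, HasDerivAt S (r * C z) z)
    (hC : ∀ z, HasDerivAt C (r * S z) z) (hCS : ∀ z, C z ^ 2 = S z ^ 2 + 1)
    (hne : ∀ z ∈ s, C z ≠ 0) :
    Set.EqOn (iteratedDeriv 1 (fun z => c * (S z * (C z)⁻¹ ^ 2)))
      (fun z => c * r * (2 * (C z)⁻¹ ^ 3 - (C z)⁻¹)) s ∧
    Set.EqOn (iteratedDeriv 2 (fun z => c * (S z * (C z)⁻¹ ^ 2)))
      (fun z => c * r ^ 2 * (S z * (C z)⁻¹ ^ 2 - 6 * (S z * (C z)⁻¹ ^ 4))) s ∧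
    Set.EqOn (iteratedDeriv 3 (fun z => c * (S z * (C z)⁻¹ ^ 2)))
      (fun z => c * r ^ 3 * (-24 * (C z)⁻¹ ^ 5 + 20 * (C z)⁻¹ ^ 3 - (C z)⁻¹)) s ∧
    Set.EqOn (iteratedDeriv 4 (fun z => c * (S z * (C z)⁻¹ ^ 2)))
      (fun z => c * r ^ 4 * (S z * (120 * (C z)⁻¹ ^ 6 - 60 * (C z)⁻¹ ^ 4 + (C z)⁻¹ ^ 2))) s := by
  have hh : ∀ z ∈ s, HasDerivAt (fun z => (C z)⁻¹) (-(r * (S z * (C z)⁻¹ ^ 2))) z := by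
    intro z hz
    refine ((hC z).fun_inv (hne z hz)).congr_deriv ?_
    rw [div_eq_mul_inv, inv_pow]; ring
  have hCh : ∀ z ∈ s, C z * (C z)⁻¹ = 1 := fun z hz => mul_inv_cancel₀ (hne z hz)
  have hSh : ∀ z ∈ s, S z ^ 2 * (C z)⁻¹ ^ 2 = 1 - (C z)⁻¹ ^ 2 := by
    intro z hz
    linear_combination (C z * (C z)⁻¹ + 1) * hCh z hz - (C z)⁻¹ ^ 2 * hCS z
  have e0 : Set.EqOn (iteratedDeriv 0 (fun z => c * (S z * (C z)⁻¹ ^ 2)))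
    (fun z => c * (S z * (C z)⁻¹ ^ 2)) s := fun z _ => by simp
  have e1 := e0.iteratedDeriv_succ_of_hasDerivAt hs
    (g := fun z => c * r * (2 * (C z)⁻¹ ^ 3 - (C z)⁻¹)) fun z hz => by
      refine (((hS z).fun_mul ((hh z hz).fun_pow 2)).const_mul c).congr_deriv ?_
      norm_num only [Nat.cast_ofNat, pow_one]
      linear_combination c * r * (C z)⁻¹ * hCh z hz - 2 * c * r * (C z)⁻¹ * hSh z hz
  have e2 := e1.iteratedDeriv_succ_of_hasDerivAt hs
    (g := fun z => c * r ^ 2 * (S z * (C z)⁻¹ ^ 2 - 6 * (S z * (C z)⁻¹ ^ 4))) fun z hz => by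
      refine (((((hh z hz).fun_pow 3).const_mul 2).fun_sub (hh z hz)).const_mul
        (c * r)).congr_deriv ?_
      norm_num only [Nat.cast_ofNat, pow_one]
      ring
  have e3 := e2.iteratedDeriv_succ_of_hasDerivAt hs
    (g := fun z => c * r ^ 3 * (-24 * (C z)⁻¹ ^ 5 + 20 * (C z)⁻¹ ^ 3 - (C z)⁻¹)) fun z hz => by
      refine ((((hS z).fun_mul ((hh z hz).fun_pow 2)).fun_sub
        (((hS z).fun_mul ((hh z hz).fun_pow 4)).const_mul 6)).const_mul (c * r ^ 2)).congr_deriv ?_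
      norm_num only [Nat.cast_ofNat, pow_one]
      linear_combination c * r ^ 3 * ((C z)⁻¹ - 6 * (C z)⁻¹ ^ 3) * hCh z hz +
        c * r ^ 3 * (-2 * (C z)⁻¹ + 24 * (C z)⁻¹ ^ 3) * hSh z hz
  refine ⟨e1, e2, e3, e3.iteratedDeriv_succ_of_hasDerivAt hs fun z hz => ?_⟩
  refine ((((((hh z hz).fun_pow 5).const_mul (-24)).fun_add
    (((hh z hz).fun_pow 3).const_mul 20)).fun_sub (hh z hz)).const_mul (c * r ^ 3)).congr_deriv ?_
  norm_num only [Nat.cast_ofNat, pow_one]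
  ring

section Complex

variable {k Z₀ ε : ℝ}

theorem hasDerivAt_sinh_two_mul (k Z₀ : ℝ) (z : ℂ) :
    HasDerivAt (fun z : ℂ => Complex.sinh (2 * (k * (z - Z₀))))
      (2 * k * Complex.cosh (2 * (k * (z - Z₀)))) z := by
  refine ((((hasDerivAt_id z).sub_const (Z₀ : ℂ)).const_mul (k : ℂ)).const_mul 2).csinh.congr_deriv ?_
  simp; ring

theorem hasDerivAt_cosh_two_mul (k Z₀ : ℝ) (z : ℂ) :
    HasDerivAt (fun z : ℂ => Complex.cosh (2 * (k * (z - Z₀))))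
      (2 * k * Complex.sinh (2 * (k * (z - Z₀)))) z := by
  refine ((((hasDerivAt_id z).sub_const (Z₀ : ℂ)).const_mul (k : ℂ)).const_mul 2).ccosh.congr_deriv ?_
  simp; ring

theorem tanhProfile_sub_eq (k ε Z₀ : ℝ) : (fun z : ℂ => (ε : ℂ) * tanhProfile k (z - Z₀)) =
    fun z => ((ε * (2 * √30 / √11) : ℝ) : ℂ) * (Complex.sinh (2 * (k * (z - Z₀))) *
      (Complex.cosh (2 * (k * (z - Z₀))))⁻¹ ^ 2) := by
  funext z
  rw [tanhProfile_eq, Complex.ofReal_mul, mul_assoc]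

theorem analyticAt_sinh_two_mul (k Z₀ : ℝ) (z : ℂ) :
    AnalyticAt ℂ (fun z : ℂ => Complex.sinh (2 * (k * (z - Z₀)))) z :=
  Differentiable.analyticAt (fun z => (hasDerivAt_sinh_two_mul k Z₀ z).differentiableAt) z

theorem analyticAt_cosh_two_mul (k Z₀ : ℝ) (z : ℂ) :
    AnalyticAt ℂ (fun z : ℂ => Complex.cosh (2 * (k * (z - Z₀)))) z :=
  Differentiable.analyticAt (fun z => (hasDerivAt_cosh_two_mul k Z₀ z).differentiableAt) z

/-- The Lean function has the value 0 at its poles, so analyticity there must be refuted: off the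
pole `f cosh² = c sinh`, and continuity of `f` would give `c sinh = 0` in the limit, whereas `sinh²
= -1`. -/
theorem cosh_ne_zero_of_analyticAt (hk : k ≠ 0) {c z : ℂ} (hc : c ≠ 0)
    (h : AnalyticAt ℂ (fun z : ℂ => c * (Complex.sinh (2 * (k * (z - Z₀))) *
      (Complex.cosh (2 * (k * (z - Z₀))))⁻¹ ^ 2)) z) :
    Complex.cosh (2 * (k * (z - Z₀))) ≠ 0 := by
  intro h0
  have hcs := Complex.cosh_sq (2 * (k * (z - Z₀)))
  have hs : Complex.sinh (2 * (k * (z - Z₀))) ≠ 0 := by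
    intro hs
    rw [h0, hs] at hcs
    norm_num at hcs
  have hk' : (k : ℂ) ≠ 0 := by exact_mod_cast hk
  have hev := (hasDerivAt_cosh_two_mul k Z₀ z).eventually_ne (c := 0)
    (mul_ne_zero (mul_ne_zero two_ne_zero hk') hs)
  have h1 := ((h.continuousAt.mul ((hasDerivAt_cosh_two_mul k Z₀ z).continuousAt.pow 2)).sub
    ((hasDerivAt_sinh_two_mul k Z₀ z).continuousAt.const_mul c)).tendsto.mono_left
      (nhdsWithin_le_nhds (s := {z}ᶜ))
  have h2 := tendsto_nhds_unique (h1.congr' (f₂ := fun _ => 0) ?_) tendsto_const_nhds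
  · simp [h0, hc, hs] at h2
  · filter_upwards [hev] with w hw
    simp only [Pi.sub_apply, Pi.mul_apply, Pi.pow_apply]
    generalize Complex.cosh (2 * (k * (w - Z₀))) = C at hw ⊢
    field_simp
    ring

theorem isMeromorphicSolution_tanhProfile (hk : k ^ 2 = 1 / (4 * √11)) (hε : ε = 1 ∨ ε = -1) :
    IsMeromorphicSolution (10 / √11) (fun z : ℂ => (ε : ℂ) * tanhProfile k (z - Z₀)) := by
  have h11p : 0 < √11 := by positivity
  have h11 : √11 ^ 2 = 11 := Real.sq_sqrt (by norm_num)
  have h30 : √30 ^ 2 = 30 := Real.sq_sqrt (by norm_num)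
  have hε2 : ε ^ 2 = 1 := by rcases hε with rfl | rfl <;> norm_num
  have hk0 : k ≠ 0 := by
    rintro rfl
    have : (0 : ℝ) < 1 / (4 * √11) := by positivity
    rw [← hk] at this
    norm_num at this
  rw [tanhProfile_sub_eq]
  set c : ℝ := ε * (2 * √30 / √11) with hc
  have hc2 : c ^ 2 = 120 / 11 := by
    rw [hc, mul_pow, div_pow, mul_pow, hε2, h11, h30]; norm_num
  have hc0 : (c : ℂ) ≠ 0 := by
    intro h
    rw [Complex.ofReal_eq_zero] at h
    rw [h] at hc2
    norm_num at hc2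
  refine ⟨fun z => ?_, fun z hz => ?_⟩
  · exact (MeromorphicAt.const _ _).mul ((analyticAt_sinh_two_mul k Z₀ z).meromorphicAt.mul
      ((analyticAt_cosh_two_mul k Z₀ z).meromorphicAt.inv.pow 2))
  · have hcz := cosh_ne_zero_of_analyticAt hk0 hc0 hz
    have hopen : IsOpen {z : ℂ | Complex.cosh (2 * (k * (z - Z₀))) ≠ 0} :=
      isOpen_ne_fun (continuous_iff_continuousAt.2 fun z =>
        (hasDerivAt_cosh_two_mul k Z₀ z).continuousAt) continuous_const
    obtain ⟨-, e2, -, e4⟩ := iteratedDeriv_sinh_div_cosh_sq hopen (c := (c : ℂ))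
      (hasDerivAt_sinh_two_mul k Z₀) (hasDerivAt_cosh_two_mul k Z₀)
      (fun z => Complex.cosh_sq _) (fun z hz => hz)
    rw [e2 hcz, e4 hcz]
    have hS := Complex.cosh_sq (2 * (k * (z - Z₀)))
    set S := Complex.sinh (2 * (k * (z - Z₀)))
    set C := Complex.cosh (2 * (k * (z - Z₀)))
    have hCh : C * C⁻¹ = 1 := mul_inv_cancel₀ hcz
    have hSh : S ^ 2 * C⁻¹ ^ 2 = 1 - C⁻¹ ^ 2 := by
      linear_combination (C * C⁻¹ + 1) * hCh - C⁻¹ ^ 2 * hS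
    have hr4 : (2 * (k : ℂ)) ^ 4 = 1 / 11 := by
      have : (2 * k) ^ 4 = 1 / 11 := by
        rw [show (2 * k) ^ 4 = 16 * (k ^ 2) ^ 2 by ring, hk, div_pow, mul_pow, h11]; norm_num
      rw [← Complex.ofReal_ofNat, ← Complex.ofReal_mul, ← Complex.ofReal_pow, this]; norm_num
    have har : ((10 / √11 : ℝ) : ℂ) * (2 * (k : ℂ)) ^ 2 = 10 / 11 := by
      have : 10 / √11 * (2 * k) ^ 2 = 10 / 11 := by
        rw [mul_pow, hk]; field_simp; rw [h11]; norm_num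
      rw [← Complex.ofReal_ofNat 2, ← Complex.ofReal_mul, ← Complex.ofReal_pow,
        ← Complex.ofReal_mul, this]; norm_num
    have hc2' : (c : ℂ) ^ 2 = 120 / 11 := by
      rw [← Complex.ofReal_pow, hc2]; norm_num
    -- The coefficients of `S C⁻²`, `S C⁻⁴`, `S C⁻⁶` vanish: `1/11 + 10/11 - 1`, `-60/11 - 60/11 +
    -- 120/11` and `120/11 - 120/11`.
    linear_combination c * (S * (120 * C⁻¹ ^ 6 - 60 * C⁻¹ ^ 4 + C⁻¹ ^ 2)) * hr4
      + c * (S * C⁻¹ ^ 2 - 6 * (S * C⁻¹ ^ 4)) * har + c * S ^ 3 * C⁻¹ ^ 6 * hc2'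
      + c * (120 / 11) * S * C⁻¹ ^ 4 * hSh

end Complex

/-! ### Converse: decay and extrema on the real line. -/

/-- From `sinh 2u = ε` follows `(ε sinh u + cosh u)² = 2 cosh² u`, and both bases are positive, so
the root may be taken. -/
theorem Real.tanh_eq_mul_sqrt_two_sub_one_iff {ε u : ℝ} (hε : ε = 1 ∨ ε = -1) :
    Real.tanh u = ε * (√2 - 1) ↔ Real.sinh (2 * u) = ε := by
  have hε2 : ε ^ 2 = 1 := by rcases hε with rfl | rfl <;> norm_num
  have hc : 0 < Real.cosh u := Real.cosh_pos u
  have hcs := Real.cosh_sq u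
  have h2 : √2 ^ 2 = 2 := Real.sq_sqrt (by norm_num)
  rw [Real.tanh_eq_sinh_div_cosh, div_eq_iff hc.ne', Real.sinh_two_mul]
  set s := Real.sinh u
  set c := Real.cosh u
  constructor
  · intro h
    have h1 : c ^ 2 * (2 * (√2 - 1)) = 1 := by
      have : s ^ 2 = (√2 - 1) ^ 2 * c ^ 2 := by rw [h, mul_pow, mul_pow, hε2]; ring
      linear_combination hcs + this + c ^ 2 * h2
    rw [h]
    linear_combination ε * h1
  · intro h
    have ht : 2 * (ε * s) * c = 1 := by linear_combination ε * h + hε2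
    have htp : 0 < ε * s := by
      by_contra hn
      nlinarith
    have h3 : (ε * s + c) ^ 2 = (√2 * c) ^ 2 := by
      linear_combination s ^ 2 * hε2 + ht - hcs - c ^ 2 * h2
    have h4 := (pow_left_inj₀ (by positivity) (by positivity) two_ne_zero).1 h3
    linear_combination ε * h4 - s * hε2

section Real

variable {k Z₀ ε : ℝ}

theorem hasDerivAt_real_sinh_two_mul (k Z₀ x : ℝ) :
    HasDerivAt (fun x : ℝ => Real.sinh (2 * (k * (x - Z₀))))
      (2 * k * Real.cosh (2 * (k * (x - Z₀)))) x := by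
  refine ((((hasDerivAt_id x).sub_const Z₀).const_mul k).const_mul 2).sinh.congr_deriv ?_
  simp; ring

theorem hasDerivAt_real_cosh_two_mul (k Z₀ x : ℝ) :
    HasDerivAt (fun x : ℝ => Real.cosh (2 * (k * (x - Z₀))))
      (2 * k * Real.sinh (2 * (k * (x - Z₀)))) x := by
  refine ((((hasDerivAt_id x).sub_const Z₀).const_mul k).const_mul 2).cosh.congr_deriv ?_
  simp; ring

theorem tanhProfile_sub_ofReal (k ε Z₀ x : ℝ) : (ε : ℂ) * tanhProfile k (x - Z₀) =
    ((ε * (2 * √30 / √11) * (Real.sinh (2 * (k * (x - Z₀))) *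
      (Real.cosh (2 * (k * (x - Z₀))))⁻¹ ^ 2) : ℝ) : ℂ) := by
  rw [tanhProfile_eq]
  push_cast
  ring

theorem realTrace_tanhProfile (k ε Z₀ : ℝ) :
    realTrace (fun z : ℂ => (ε : ℂ) * tanhProfile k (z - Z₀)) =
      fun x => ε * (2 * √30 / √11) * (Real.sinh (2 * (k * (x - Z₀))) *
        (Real.cosh (2 * (k * (x - Z₀))))⁻¹ ^ 2) := by
  funext x
  simp only [realTrace]
  rw [tanhProfile_sub_ofReal, Complex.ofReal_re]

theorem isRealOnReals_tanhProfile (k ε Z₀ : ℝ) :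
    IsRealOnReals (fun z : ℂ => (ε : ℂ) * tanhProfile k (z - Z₀)) := by
  intro x
  refine ⟨?_, ?_⟩
  · rw [tanhProfile_sub_eq]
    refine analyticAt_const.mul ((analyticAt_sinh_two_mul k Z₀ x).mul
      (((analyticAt_cosh_two_mul k Z₀ x).fun_inv ?_).fun_pow 2))
    have := (Real.cosh_pos (2 * (k * (x - Z₀)))).ne'
    exact_mod_cast this
  · simp only [tanhProfile_sub_ofReal, Complex.ofReal_im]

theorem Real.abs_self_le_cosh (x : ℝ) : |x| ≤ Real.cosh x := by
  refine (Real.abs_self_le_abs_sinh x).trans (abs_le_of_sq_le_sq ?_ (Real.cosh_pos x).le)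
  rw [Real.cosh_sq]; linarith

theorem isHomoclinic_tanhProfile (hk : k ≠ 0) (hε : ε ≠ 0) :
    IsHomoclinic (realTrace (fun z : ℂ => (ε : ℂ) * tanhProfile k (z - Z₀))) := by
  rw [realTrace_tanhProfile]
  have hc : ε * (2 * √30 / √11) ≠ 0 := by positivity
  generalize ε * (2 * √30 / √11) = c at hc
  have key : ∀ l : Filter ℝ, Tendsto (fun x : ℝ => |x - Z₀|) l atTop →
      Tendsto (fun x => c * (Real.sinh (2 * (k * (x - Z₀))) *
        (Real.cosh (2 * (k * (x - Z₀))))⁻¹ ^ 2)) l (𝓝 0) ∧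
      ∀ j ∈ Finset.Icc 1 3, Tendsto (iteratedDeriv j (fun x => c * (Real.sinh (2 * (k * (x - Z₀))) *
        (Real.cosh (2 * (k * (x - Z₀))))⁻¹ ^ 2))) l (𝓝 0) := by
    intro l hl
    have hh : Tendsto (fun x : ℝ => (Real.cosh (2 * (k * (x - Z₀))))⁻¹) l (𝓝 0) := by
      refine tendsto_inv_atTop_zero.comp (tendsto_atTop_mono (fun x => Real.abs_self_le_cosh _) ?_)
      simp only [abs_mul]
      exact (hl.const_mul_atTop (abs_pos.2 hk)).const_mul_atTop (by norm_num)
    have hSh : Tendsto (fun x => Real.sinh (2 * (k * (x - Z₀))) *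
        (Real.cosh (2 * (k * (x - Z₀))))⁻¹ ^ 2) l (𝓝 0) := by
      refine squeeze_zero_norm (fun x => ?_) hh
      have hp := Real.cosh_pos (2 * (k * (x - Z₀)))
      have h1 : |Real.sinh (2 * (k * (x - Z₀)))| ≤ Real.cosh (2 * (k * (x - Z₀))) := by
        refine abs_le_of_sq_le_sq ?_ hp.le
        rw [Real.cosh_sq]; linarith
      rw [Real.norm_eq_abs, abs_mul, abs_of_nonneg (by positivity : (0 : ℝ) ≤ (_)⁻¹ ^ 2)]
      calc |Real.sinh (2 * (k * (x - Z₀)))| * (Real.cosh (2 * (k * (x - Z₀))))⁻¹ ^ 2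
          ≤ Real.cosh (2 * (k * (x - Z₀))) * (Real.cosh (2 * (k * (x - Z₀))))⁻¹ ^ 2 := by gcongr
        _ = _ := by field_simp
    refine ⟨by simpa using hSh.const_mul c, ?_⟩
    obtain ⟨e1, e2, e3, -⟩ := iteratedDeriv_sinh_div_cosh_sq (s := Set.univ) isOpen_univ (c := c)
      (hasDerivAt_real_sinh_two_mul k Z₀) (hasDerivAt_real_cosh_two_mul k Z₀)
      (fun x => Real.cosh_sq _) (fun x _ => (Real.cosh_pos _).ne')
    have e : ∀ {f g : ℝ → ℝ}, Set.EqOn f g Set.univ → Tendsto g l (𝓝 0) → Tendsto f l (𝓝 0) :=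
      fun h => by rw [Set.eqOn_univ] at h; rw [h]; exact id
    intro j hj
    obtain rfl | rfl | rfl : j = 1 ∨ j = 2 ∨ j = 3 := by
      rw [Finset.mem_Icc] at hj; omega
    · refine e e1 ?_
      simpa using (((hh.pow 3).const_mul 2).sub hh).const_mul (c * (2 * k))
    · refine e e2 ?_
      have h4 := hSh.mul (hh.pow 2)
      have h5 := (hSh.sub (h4.const_mul 6)).const_mul (c * (2 * k) ^ 2)
      rw [show c * (2 * k) ^ 2 * (0 - 6 * (0 * 0 ^ 2)) = 0 by ring] at h5
      refine h5.congr fun x => ?_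
      ring
    · refine e e3 ?_
      simpa using ((((hh.pow 5).const_mul (-24)).add ((hh.pow 3).const_mul 20)).sub hh).const_mul
        (c * (2 * k) ^ 3)
  obtain ⟨hb, hb'⟩ := key atBot (tendsto_abs_atBot_atTop.comp
    (tendsto_atBot_add_const_right _ (-Z₀) tendsto_id))
  obtain ⟨ht, ht'⟩ := key atTop (tendsto_abs_atTop_atTop.comp
    (tendsto_atTop_add_const_right _ (-Z₀) tendsto_id))
  refine ⟨⟨Z₀, Z₀ + 1, ?_⟩, 0, ⟨hb, ht⟩, fun j hj => ⟨hb' j hj, ht' j hj⟩⟩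
  have h1 : Real.sinh (2 * k) ≠ 0 := by
    rw [Ne, Real.sinh_eq_zero]; simpa
  have h2 := (Real.cosh_pos (2 * k)).ne'
  simp [hc, h1, h2]

theorem realTrace_neg_tanhProfile (k ε Z₀ : ℝ) :
    realTrace (fun z : ℂ => ((-ε : ℝ) : ℂ) * tanhProfile k (z - Z₀)) =
      fun x => -realTrace (fun z : ℂ => (ε : ℂ) * tanhProfile k (z - Z₀)) x := by
  rw [realTrace_tanhProfile, realTrace_tanhProfile]
  funext x
  ring

theorem two_mul_sqrt_div_half : 2 * √30 / √11 / 2 = √(30 / 11) := by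
  rw [Real.sqrt_div (by norm_num)]; ring

theorem realTrace_tanhProfile_of_sinh_eq {δ x : ℝ} (hδ : δ = 1 ∨ δ = -1)
    (h : Real.sinh (2 * (k * (x - Z₀))) = δ) :
    realTrace (fun z : ℂ => (ε : ℂ) * tanhProfile k (z - Z₀)) x = ε * δ * √(30 / 11) := by
  rw [realTrace_tanhProfile, ← two_mul_sqrt_div_half]
  have h1 := Real.cosh_sq (2 * (k * (x - Z₀)))
  have h2 : δ ^ 2 = 1 := by rcases hδ with rfl | rfl <;> norm_num
  rw [h, h2] at h1
  simp only [inv_pow, h1, h]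
  ring

theorem abs_realTrace_tanhProfile_le (hε : ε = 1 ∨ ε = -1) (x : ℝ) :
    |realTrace (fun z : ℂ => (ε : ℂ) * tanhProfile k (z - Z₀)) x| ≤ √(30 / 11) := by
  rw [realTrace_tanhProfile, ← two_mul_sqrt_div_half]
  have hε1 : |ε| = 1 := by rcases hε with rfl | rfl <;> norm_num
  have hp : 0 < Real.cosh (2 * (k * (x - Z₀))) ^ 2 := by
    have := Real.cosh_pos (2 * (k * (x - Z₀))); positivity
  have h1 := Real.cosh_sq (2 * (k * (x - Z₀)))
  have h2 : |Real.sinh (2 * (k * (x - Z₀))) * (Real.cosh (2 * (k * (x - Z₀))))⁻¹ ^ 2| ≤ 1 / 2 := by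
    rw [inv_pow, ← div_eq_mul_inv, abs_div, abs_of_pos hp, div_le_iff₀ hp, h1,
      ← sq_abs (Real.sinh _)]
    nlinarith [sq_nonneg (|Real.sinh (2 * (k * (x - Z₀)))| - 1)]
  rw [abs_mul, abs_mul, hε1, abs_of_nonneg (by positivity : 0 ≤ 2 * √30 / √11)]
  have h3 : 0 ≤ 2 * √30 / √11 := by positivity
  nlinarith

/-- Critical points satisfy `cosh² = 2`, that is `sinh = ±ε`. The value at `sinh = -ε` is the global
minimum, so a local maximum there would make the function locally constant and `sinh` with it. At
`sinh = ε` the global bound is attained. -/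
theorem isLocalMax_tanhProfile_iff (hk : k ≠ 0) (hε : ε = 1 ∨ ε = -1) (x : ℝ) :
    IsLocalMax (realTrace (fun z : ℂ => (ε : ℂ) * tanhProfile k (z - Z₀))) x ↔
      Real.sinh (2 * (k * (x - Z₀))) = ε := by
  have hε0 : ε ≠ 0 := by rcases hε with rfl | rfl <;> norm_num
  have hε2 : ε * ε = 1 := by rcases hε with rfl | rfl <;> norm_num
  have hεn : -ε = 1 ∨ -ε = -1 := by rcases hε with rfl | rfl <;> norm_num
  constructor
  · intro h
    have hd := h.deriv_eq_zero
    have hu := realTrace_tanhProfile k ε Z₀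
    obtain ⟨e1, -, -, -⟩ := iteratedDeriv_sinh_div_cosh_sq (s := Set.univ) isOpen_univ
      (c := ε * (2 * √30 / √11))
      (hasDerivAt_real_sinh_two_mul k Z₀) (hasDerivAt_real_cosh_two_mul k Z₀)
      (fun x => Real.cosh_sq _) (fun x _ => (Real.cosh_pos _).ne')
    have e1x := e1 (Set.mem_univ x)
    rw [← hu, iteratedDeriv_one, hd] at e1x
    have hp := Real.cosh_pos (2 * (k * (x - Z₀)))
    have hcs := Real.cosh_sq (2 * (k * (x - Z₀)))
    have hC2 : Real.cosh (2 * (k * (x - Z₀))) ^ 2 = 2 := by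
      have hc : ε * (2 * √30 / √11) * (2 * k) ≠ 0 := by positivity
      have h0 := (mul_eq_zero.1 e1x.symm).resolve_left hc
      generalize Real.cosh (2 * (k * (x - Z₀))) = C at hp h0 ⊢
      field_simp at h0
      linarith
    have hS : Real.sinh (2 * (k * (x - Z₀))) ^ 2 = ε ^ 2 := by
      rw [sq ε, hε2]; linarith
    rcases sq_eq_sq_iff_eq_or_eq_neg.1 hS with hS | hS
    · exact hS
    exfalso
    have hux := realTrace_tanhProfile_of_sinh_eq (ε := ε) hεn hS
    have hev : ∀ᶠ y in 𝓝 x, Real.sinh (2 * (k * (y - Z₀))) = -ε := by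
      filter_upwards [h] with y hy
      have h1 := (abs_le.1 (abs_realTrace_tanhProfile_le (k := k) (Z₀ := Z₀) hε y)).1
      have h2 : realTrace (fun z : ℂ => (ε : ℂ) * tanhProfile k (z - Z₀)) y = -√(30 / 11) := by
        refine le_antisymm (hy.trans (le_of_eq ?_)) h1
        rw [hux]
        linear_combination -√(30 / 11) * hε2
      rw [hu, ← two_mul_sqrt_div_half] at h2
      have hcy := Real.cosh_sq (2 * (k * (y - Z₀)))
      have hpy := Real.cosh_pos (2 * (k * (y - Z₀)))
      have hb : 0 < 2 * √30 / √11 := by positivity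
      have h3 : 2 * ε * Real.sinh (2 * (k * (y - Z₀))) = -Real.cosh (2 * (k * (y - Z₀))) ^ 2 := by
        refine mul_left_cancel₀ hb.ne' ?_
        generalize 2 * √30 / √11 = b at h2 ⊢
        dsimp only at h2
        generalize Real.cosh (2 * (k * (y - Z₀))) = C at hpy h2 ⊢
        generalize Real.sinh (2 * (k * (y - Z₀))) = S at h2 ⊢
        field_simp at h2
        linear_combination h2
      have h4 : (Real.sinh (2 * (k * (y - Z₀))) + ε) ^ 2 = 0 := by
        linear_combination h3 - hcy + hε2
      have h5 := pow_eq_zero_iff (two_ne_zero) |>.1 h4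
      linarith
    obtain ⟨y, hy, hyx⟩ := ((hev.filter_mono (nhdsWithin_le_nhds (s := {x}ᶜ))).and
      self_mem_nhdsWithin).exists
    rw [← hS] at hy
    have h6 := Real.sinh_injective hy
    have h7 : k * (y - x) = 0 := by linear_combination h6 / 2
    rcases mul_eq_zero.1 h7 with h7 | h7
    · exact hk h7
    · exact hyx (by simpa using sub_eq_zero.1 h7)
  · intro h
    refine Eventually.of_forall fun y => ?_
    rw [realTrace_tanhProfile_of_sinh_eq hε h, hε2, one_mul]
    exact (le_abs_self _).trans (abs_realTrace_tanhProfile_le hε y)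

theorem isLocalMin_tanhProfile_iff (hk : k ≠ 0) (hε : ε = 1 ∨ ε = -1) (x : ℝ) :
    IsLocalMin (realTrace (fun z : ℂ => (ε : ℂ) * tanhProfile k (z - Z₀))) x ↔
      Real.sinh (2 * (k * (x - Z₀))) = -ε := by
  have hεn : -ε = 1 ∨ -ε = -1 := by rcases hε with rfl | rfl <;> norm_num
  rw [← isLocalMax_tanhProfile_iff hk hεn, realTrace_neg_tanhProfile]
  exact ⟨fun h => h.neg, fun h => by simpa using h.neg⟩

theorem existsUnique_sinh_eq (hk : k ≠ 0) (δ : ℝ) : ∃! Z : ℝ, Real.sinh (2 * (k * (Z - Z₀))) = δ := by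
  refine ⟨Z₀ + Real.arsinh δ / (2 * k), ?_, fun y hy => ?_⟩
  · have : 2 * (k * (Z₀ + Real.arsinh δ / (2 * k) - Z₀)) = Real.arsinh δ := by field_simp; ring
    simp only [this, Real.sinh_arsinh]
  · rw [← hy, Real.arsinh_sinh]
    field_simp
    ring

end Real

theorem mainTheorem3 (k : ℝ) (hk : k ^ 2 = 1 / (4 * √11)) :
    -- necessity of the value of `a`, and uniqueness up to sign and translation
    (∀ (a : ℝ) (U : ℂ → ℂ),
      IsMeromorphicSolution a U → IsRealOnReals U → IsHomoclinic (realTrace U) →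
        a = 10 / √11 ∧
        ∃ ε : ℝ, (ε = 1 ∨ ε = -1) ∧ ∃ Z₀ : ℝ,
          ∀ z : ℂ, AnalyticAt ℂ U z → U z = (ε : ℂ) * tanhProfile k (z - (Z₀ : ℂ))) ∧
    -- existence, and the extrema on the real line
    (∀ ε : ℝ, (ε = 1 ∨ ε = -1) → ∀ (Z₀ : ℝ) (U : ℂ → ℂ),
      (U = fun z : ℂ => (ε : ℂ) * tanhProfile k (z - (Z₀ : ℂ))) →
        IsMeromorphicSolution (10 / √11) U ∧ IsRealOnReals U ∧ IsHomoclinic (realTrace U) ∧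
        (∃! Z : ℝ, IsLocalMax (realTrace U) Z) ∧
        (∃! Z : ℝ, IsLocalMin (realTrace U) Z) ∧
        (∀ Z : ℝ, IsLocalMax (realTrace U) Z ↔ Real.tanh (k * (Z - Z₀)) = ε * (√2 - 1)) ∧
        (∀ Z : ℝ, IsLocalMin (realTrace U) Z ↔ Real.tanh (k * (Z - Z₀)) = -(ε * (√2 - 1))) ∧
        (∀ Z : ℝ, IsLocalMax (realTrace U) Z → realTrace U Z = √(30 / 11)) ∧
        (∀ Z : ℝ, IsLocalMin (realTrace U) Z → realTrace U Z = -√(30 / 11)) ∧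
        (∀ Z : ℝ, |realTrace U Z| ≤ √(30 / 11))) := by
  refine ⟨fun a U hU hr hh => hU.eq_tanhProfile hk hr hh, ?_⟩
  rintro ε hε Z₀ U rfl
  have hk0 : k ≠ 0 := by
    rintro rfl
    have : (0 : ℝ) < 1 / (4 * √11) := by positivity
    rw [← hk] at this
    norm_num at this
  have hε0 : ε ≠ 0 := by rcases hε with rfl | rfl <;> norm_num
  have hε2 : ε * ε = 1 := by rcases hε with rfl | rfl <;> norm_num
  have hεn : -ε = 1 ∨ -ε = -1 := by rcases hε with rfl | rfl <;> norm_num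
  have hmax := isLocalMax_tanhProfile_iff (Z₀ := Z₀) hk0 hε
  have hmin := isLocalMin_tanhProfile_iff (Z₀ := Z₀) hk0 hε
  refine ⟨isMeromorphicSolution_tanhProfile hk hε, isRealOnReals_tanhProfile k ε Z₀,
    isHomoclinic_tanhProfile hk0 hε0, ?_, ?_, fun Z => ?_, fun Z => ?_, fun Z hZ => ?_,
    fun Z hZ => ?_, abs_realTrace_tanhProfile_le hε⟩
  · simpa only [hmax] using existsUnique_sinh_eq hk0 ε
  · simpa only [hmin] using existsUnique_sinh_eq hk0 (-ε)
  · rw [hmax, Real.tanh_eq_mul_sqrt_two_sub_one_iff hε]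
  · rw [hmin, ← neg_mul, Real.tanh_eq_mul_sqrt_two_sub_one_iff hεn]
  · rw [realTrace_tanhProfile_of_sinh_eq hε ((hmax Z).1 hZ), hε2, one_mul]
  · rw [realTrace_tanhProfile_of_sinh_eq hεn ((hmin Z).1 hZ), mul_neg, hε2, neg_one_mul]
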